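/- Let $p$ be a prime, $c\ge 1$ and $\eta\ge 1$ integers, and $\gamma = 1-p^{-c}$. For a prime power $q$ and $0\le d\le q-1$ let $\mathrm{RS}_q(d)\subseteq\mathbb F_q^q$ be the code of all evaluation vectors $(g(t))_{t\in\mathbb F_q}$ with $g\in\mathbb F_q[T]$, $\deg g\le d$, and let $\mathrm{Lift}^\eta\mathrm{RS}_q(d)\subseteq\mathbb F_q^{q^2}$ be the code of all evaluation vectors $(f(x,y))_{(x,y)\in\mathbb F_q^2}$, where $f\in\mathbb F_q[X,Y]$ is such that $(f(t,\phi(t)))_{t\in\mathbb F_q}\in\mathrm{RS}_q(d)$ for every $\phi\in\mathbb F_q[T]$ with $\deg\phi\le\eta$. Put $$T_m=\Big(\Big\lfloor\tfrac{p^m-1}{\eta}\Big\rfloor+1\Big)\Big(p^m-\tfrac{\eta}{2}\Big\lfloor\tfrac{p^m-1}{\eta}\Big\rfloor\Big),\qquad N_0=1,\qquad N_m=p^{2m}-\sum_{\nu=0}^{m-1}N_\nu T_{m-\nu}\quad(m\ge1).$$ For $e\ge c+1$ let $\mathcal C_e=\mathrm{Lift}^\eta\mathrm{RS}_{p^e}(\gamma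 p^e)$, a linear code of length $n_e=p^{2e}$, and let $R_e=\dim\mathcal C_e/n_e$ be its information rate. Then: 1. The limit $\lim_{e\to\infty}R_e$ exists and $$\lim_{e\to\infty}R_e\ \ge\ \frac1{2\eta}\sum_{\epsilon=0}^{c-1}\big(p^{-\epsilon}-p^{-c}\big)^2N_\epsilon\ >\ 0 .$$ 2. The sequence $(\mathcal C_e)$ is asymptotically good: $n_e\to\infty$, and there are constants $\rho,\delta>0$ such that, for all large $e$, the rate of $\mathcal C_e$ is at least $\rho$ and its minimum distance is at least $\delta n_e$. 3. The codes $\mathcal C_e$ are locally correctable from a constant fraction of errors: for every $e\ge c+1$ and every $0<\delta\le(1-\gamma)/4$, the code $\mathcal C_e$ is $(p^e-1,\delta,\epsilon)$-locally correctable with $\epsilon=\frac{3}{1-\gamma}\delta$, and even with $\epsilon=\frac{2}{1-\gamma}\delta$ if $p^e-\gamma p^e$ is even. Moreover $p^e-1\le\dim\mathcal C_e$ for all large $e$. Here a code $\mathcal C\subseteq\mathbb F_q^n$ is $(\ell,\delta,\epsilon)$-locally correctable if there is a probabilistic algorithm which, given a coordinate $i$ and oracle access to a word $y\in\mathbb F_q^n$,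 reads at most $\ell$ coordinates of $y$, and which outputs $c_i$ with probability at least $1-\epsilon$ whenever $y$ is at Hamming distance at most $\delta n$ from the codeword $c\in\mathcal C$. -/

import Mathlib

open Filter Topology

/-! ### Linear codes -/

section Codes

variable {F ι : Type*} [Field F] [Fintype ι]

/-- The information rate `dim C / n` of a linear code of length `n = |ι|`. -/
noncomputable def codeRate (C : Submodule F (ι → F)) : ℝ :=
  (Module.finrank F C : ℝ) / (Fintype.card ι : ℝ)

/-- The minimum distance of a code: the least Hamming distance between two distinct codewords
(with value `0` for a code that has no two distinct codewords). -/
noncomputable def codeMinDist [DecidableEq F] (C : Submodule F (ι → F)) : ℕ :=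
  sInf {m : ℕ | ∃ x ∈ C, ∃ y ∈ C, x ≠ y ∧ m = hammingDist x y}

end Codes

/-- A sequence of linear codes is asymptotically good if the lengths tend to infinity while the
information rate and the relative minimum distance stay bounded away from zero. -/
def AsymptoticallyGood {F ι : ℕ → Type*} [∀ e, Field (F e)] [∀ e, DecidableEq (F e)]
    [∀ e, Fintype (ι e)] (C : ∀ e, Submodule (F e) (ι e → F e)) : Prop :=
  Tendsto (fun e => Fintype.card (ι e)) atTop atTop ∧
    ∃ ρ > (0 : ℝ), ∃ δ > (0 : ℝ), ∀ᶠ e in atTop,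
      ρ ≤ codeRate (C e) ∧ δ * (Fintype.card (ι e) : ℝ) ≤ (codeMinDist (C e) : ℝ)

/-! ### Local correction -/

/-- A deterministic algorithm with oracle access to a word `y : ι → F`: it either stops and
outputs a symbol, or reads one coordinate of `y` and continues depending on the symbol read
(so queries may be adaptive). -/
inductive OracleAlg (ι F : Type*) where
  | output (a : F) : OracleAlg ι F
  | read (i : ι) (next : F → OracleAlg ι F) : OracleAlg ι F

namespace OracleAlg

variable {ι F : Type*}

/-- The output of the algorithm on the word `y`. -/
def run (y : ι → F) : OracleAlg ι F → F
  | output a => a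
  | read i next => run y (next (y i))

/-- The number of coordinates of `y` read by the algorithm. -/
def numReads (y : ι → F) : OracleAlg ι F → ℕ
  | output _ => 0
  | read i next => numReads y (next (y i)) + 1

end OracleAlg

/-- `C` is `(ℓ, δ, ε)`-locally correctable: there is a probabilistic algorithm (a probability
distribution on deterministic oracle algorithms for every input coordinate `i`) that always reads
at most `ℓ` coordinates of the word `y`, and that outputs `c i` with probability at least `1 - ε`
whenever `y` is at Hamming distance at most `δ n` from the codeword `c`. -/
def IsLocallyCorrectable {F ι : Type*} [Field F] [DecidableEq F] [Fintype ι]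
    (C : Submodule F (ι → F)) (ℓ : ℕ) (δ ε : ℝ) : Prop :=
  ∃ Dec : ι → PMF (OracleAlg ι F),
    (∀ i, ∀ A ∈ (Dec i).support, ∀ y : ι → F, A.numReads y ≤ ℓ) ∧
    ∀ (i : ι) (y c : ι → F), c ∈ C → (hammingDist y c : ℝ) ≤ δ * (Fintype.card ι : ℝ) →
      1 - ε ≤ (((Dec i).map (fun A => A.run y)) (c i)).toReal

/-! ### Reed-Solomon codes and their weighted lifts -/

section Lift

variable (F : Type*) [Field F]

/-- The evaluation map `F[T] → F^F`. -/
noncomputable def evLine : Polynomial F →ₗ[F] (F → F) :=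
  LinearMap.pi fun t => Polynomial.leval t

/-- The evaluation map `F[X, Y] → F^(F²)`. -/
noncomputable def evPlane : MvPolynomial (Fin 2) F →ₗ[F] ((Fin 2 → F) → F) :=
  LinearMap.pi fun x => (MvPolynomial.aeval x).toLinearMap

/-- The full-length Reed-Solomon code: evaluations of polynomials of degree at most `d`. -/
noncomputable def RSCode (d : ℕ) : Submodule F (F → F) :=
  (Polynomial.degreeLE F d).map (evLine F)

/-- The polynomials `f(X, Y)` such that for every `η`-line `L = (T, φ(T))`, `deg φ ≤ η`, the
evaluation of `f ∘ L = f(T, φ(T))` is a Reed-Solomon codeword. -/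
noncomputable def liftPolys (η d : ℕ) : Submodule F (MvPolynomial (Fin 2) F) :=
  ⨅ φ ∈ {φ : Polynomial F | φ.natDegree ≤ η},
    (RSCode F d).comap (evLine F ∘ₗ (MvPolynomial.aeval ![Polynomial.X, φ]).toLinearMap)

/-- The `η`-lifting of the Reed-Solomon code `RS(d)`, a code of length `|F|²`. -/
noncomputable def liftRS (η d : ℕ) : Submodule F ((Fin 2 → F) → F) :=
  (liftPolys F η d).map (evPlane F)

theorem mem_liftRS {η d : ℕ} {v : (Fin 2 → F) → F} :
    v ∈ liftRS F η d ↔ ∃ f : MvPolynomial (Fin 2) F,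
      (∀ φ : Polynomial F, φ.natDegree ≤ η →
        (fun t => (MvPolynomial.aeval ![Polynomial.X, φ] f : Polynomial F).eval t) ∈ RSCode F d) ∧
      (fun x => MvPolynomial.eval x f) = v := by
  simp only [liftRS, liftPolys, Submodule.mem_map, Submodule.mem_iInf, Submodule.mem_comap]
  rfl

end Lift

/-! ### The counting sequences -/

/-- `T_m = (⌊(p^m - 1)/η⌋ + 1) (p^m - (η/2) ⌊(p^m - 1)/η⌋)`. -/
noncomputable def seqT (p η m : ℕ) : ℝ :=
  (((p ^ m - 1) / η : ℕ) + 1) * ((p : ℝ) ^ m - (η : ℝ) / 2 * ((p ^ m - 1) / η : ℕ))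

/-- `N_0 = 1` and `N_m = p^(2m) - ∑_{ν < m} N_ν T_{m-ν}`. -/
noncomputable def seqN (p η : ℕ) : ℕ → ℝ
  | 0 => 1
  | m + 1 => (p : ℝ) ^ (2 * (m + 1)) -
      ∑ ν : Fin (m + 1), seqN p η ν.1 * seqT p η (m + 1 - ν.1)
decreasing_by exact ν.2

/-!
Along a curve `Y = φ(X)` the monomial `X ^ i Y ^ j` expands multinomially in the coefficients
of `φ`, and by Kummer's theorem exactly the carry-free terms survive. Letting the coefficients vary
separates the monomials, so a basis of the lifted code is given by the good monomials: those for
which every surviving exponent, reduced to `[0, q - 1]`, is at most `d`. The rate is therefore the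
proportion of good pairs `(i, j)` among the exponents below `q`.

For `q = p ^ e` and `d = q - p ^ (e - c)`, the low `e - ν` digits of a surviving exponent represent
at most `u + η v`, where `u` and `v` are given by the low `e - ν` digits of `i` and `j`. If this is
less than `p ^ (e - ν) - p ^ (e - c) - η` for some `ν < c`, then `(i, j)` is good. Sorting all pairs
by the largest low part with `u + η v < p ^ (e - ν)` gives the recursion for `N_ν`, the `T_m`
counting lattice points of triangles, and sorting these good pairs gives the lower bound.

A surviving exponent with residue modulo `q` above `d` whose reduction causes no carry makes a pair
bad in a way that persists when digits are appended, so the density of these stably bad pairs is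
monotone and bounded. For the other bad pairs no digit can be moved within a decomposition without
reaching the stable case, which confines `i + η j` to boundedly many residues modulo `p ^ (e - c)`.
Their density tends to zero, and the rate converges.

For distance and local correction only the lines through a point `x` matter: on each of them a
codeword is a Reed-Solomon word, and two of them share no point besides `x`, so few errors can
spoil only few lines.
-/

/-! ### Multinomial coefficients modulo a prime -/

section CarryFree

variable {κ : Type*} [Fintype κ] {p : ℕ} {l : κ → ℕ}

/-- The base-`p` addition of the numbers `l k` produces no carries. Instead of speaking of digits,
the condition says that the last `m` digits always sum to less than `p ^ m`. -/
def CarryFree (p : ℕ) (l : κ → ℕ) : Prop :=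
  ∀ m, ∑ k, l k % p ^ m < p ^ m

theorem CarryFree.sum_mod (h : CarryFree p l) (m : ℕ) :
    ∑ k, l k % p ^ m = (∑ k, l k) % p ^ m := by
  rw [Finset.sum_nat_mod, Nat.mod_eq_of_lt (h m)]

theorem carryFree_single [DecidableEq κ] (hp : 0 < p) (k : κ) (n : ℕ) :
    CarryFree p (Pi.single k n) := by
  intro m
  rw [Finset.sum_eq_single k (fun k' _ hk' => by simp [hk']) (by simp)]
  exact Nat.mod_lt _ (pow_pos hp m)

theorem sum_div_eq_add (l : κ → ℕ) {n : ℕ} (hn : 0 < n) :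
    (∑ k, l k) / n = ∑ k, l k / n + (∑ k, l k % n) / n := by
  have h : ∑ k, l k = n * ∑ k, l k / n + ∑ k, l k % n := by
    rw [Finset.mul_sum, ← Finset.sum_add_distrib]
    exact Finset.sum_congr rfl fun k _ => (Nat.div_add_mod _ _).symm
  rw [h, Nat.mul_add_div hn]

theorem sum_div_eq_iff (l : κ → ℕ) {n : ℕ} (hn : 0 < n) :
    ∑ k, l k / n = (∑ k, l k) / n ↔ ∑ k, l k % n < n := by
  rw [sum_div_eq_add l hn, left_eq_add, Nat.div_eq_zero_iff]
  omega

theorem factorization_multinomial_add (hp : p.Prime) (l : κ → ℕ) :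
    (Nat.multinomial Finset.univ l).factorization p +
        ∑ i ∈ Finset.Ico 1 (Nat.log p (∑ k, l k) + 1), ∑ k, l k / p ^ i =
      ∑ i ∈ Finset.Ico 1 (Nat.log p (∑ k, l k) + 1), (∑ k, l k) / p ^ i := by
  rw [← Nat.factorization_factorial hp (Nat.lt_succ_self _), ← Nat.multinomial_spec,
    Nat.factorization_mul (Finset.prod_ne_zero_iff.2 fun k _ => Nat.factorial_ne_zero _)
      (Nat.multinomial_pos _ _).ne', Nat.factorization_prod fun k _ => Nat.factorial_ne_zero _,
    Finsupp.add_apply, Finset.sum_comm, add_comm, Finsupp.finsetSum_apply]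
  congr 1
  refine Finset.sum_congr rfl fun k _ => (Nat.factorization_factorial hp ?_).symm
  exact Nat.lt_succ_of_le (Nat.log_mono_right (Finset.single_le_sum (fun _ _ => Nat.zero_le _)
    (Finset.mem_univ k)))

theorem carryFree_iff_sum_div (hp : 1 < p) :
    CarryFree p l ↔ ∀ i ∈ Finset.Ico 1 (Nat.log p (∑ k, l k) + 1),
      ∑ k, l k / p ^ i = (∑ k, l k) / p ^ i := by
  refine ⟨fun h i _ => (sum_div_eq_iff l (by positivity)).2 (h i), fun h m => ?_⟩
  rcases Nat.eq_zero_or_pos m with rfl | hm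
  · simp [Nat.mod_one]
  rcases lt_or_ge (Nat.log p (∑ k, l k)) m with hlog | hlog
  · exact (Finset.sum_le_sum fun k _ => Nat.mod_le _ _).trans_lt (Nat.lt_pow_of_log_lt hp hlog)
  · exact (sum_div_eq_iff l (by positivity)).1 (h m (Finset.mem_Ico.2 ⟨hm, by omega⟩))

theorem not_dvd_multinomial_iff_carryFree (hp : p.Prime) :
    ¬ p ∣ Nat.multinomial Finset.univ l ↔ CarryFree p l := by
  have hfac := factorization_multinomial_add hp l
  have hzero : ¬ p ∣ Nat.multinomial Finset.univ l ↔
      (Nat.multinomial Finset.univ l).factorization p = 0 := by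
    simp [Nat.factorization_eq_zero_iff, hp, (Nat.multinomial_pos Finset.univ l).ne']
  rw [hzero, carryFree_iff_sum_div hp.one_lt, ← Finset.sum_eq_sum_iff_of_le fun i _ => by
    rw [sum_div_eq_add l (pow_pos hp.pos i)]; exact Nat.le_add_right _ _]
  omega

theorem multinomial_cast_eq_zero_iff {F : Type*} [Field F] [Finite F] [CharP F p] :
    (Nat.multinomial Finset.univ l : F) = 0 ↔ ¬ CarryFree p l := by
  rw [CharP.cast_eq_zero_iff F p, ← not_dvd_multinomial_iff_carryFree
    ((CharP.char_is_prime_or_zero F p).resolve_right (CharP.char_ne_zero_of_finite F p)), not_not]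

end CarryFree

/-! ### Monomials on a finite field -/

section RedExp

variable {q n : ℕ}

/-- The exponent in `[0, q - 1]` that defines the same power function on a field with `q`
elements as `n`; the exponents `0` and `q - 1` are distinguished by the value at `0`. -/
def redExp (q n : ℕ) : ℕ := if n = 0 then 0 else (n - 1) % (q - 1) + 1

theorem redExp_lt (hq : 1 < q) (n : ℕ) : redExp q n < q := by
  unfold redExp
  split_ifs
  · omega
  · have := Nat.mod_lt (n - 1) (show 0 < q - 1 by omega)
    omega

theorem redExp_of_lt (hn : n < q) : redExp q n = n := by
  unfold redExp
  split_ifs with h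
  · exact h.symm
  · rw [Nat.mod_eq_of_lt (by omega)]
    omega

theorem redExp_modEq (q n : ℕ) : redExp q n ≡ n [MOD (q - 1)] := by
  unfold redExp
  split_ifs with h
  · rw [h]
  · simpa [Nat.sub_add_cancel (Nat.pos_of_ne_zero h)] using
      (Nat.mod_modEq (n - 1) (q - 1)).add_right 1

theorem redExp_eq_of_modEq {s : ℕ} (h : n ≡ s [MOD (q - 1)]) (hn : 0 < n) (hs : 0 < s)
    (hsq : s < q) : redExp q n = s := by
  have hmod : n - 1 ≡ s - 1 [MOD (q - 1)] :=
    Nat.ModEq.add_right_cancel' 1 (by rwa [Nat.sub_add_cancel hn, Nat.sub_add_cancel hs])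
  rw [redExp, if_neg hn.ne', hmod, Nat.mod_eq_of_lt (by omega)]
  omega

theorem add_div_modEq_pred (q n : ℕ) : n % q + n / q ≡ n [MOD (q - 1)] := by
  rcases q with _ | q
  · simp [Nat.ModEq]
  · conv_rhs => rw [← Nat.mod_add_div n (q + 1), add_mul, one_mul, add_comm (q * _), ← add_assoc]
    simp [Nat.ModEq]

theorem redExp_eq_mod_add_div (h : n % q + n / q < q) : redExp q n = n % q + n / q := by
  rcases Nat.eq_zero_or_pos n with rfl | hn
  · simp [redExp]
  refine redExp_eq_of_modEq (add_div_modEq_pred q n).symm hn ?_ h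
  refine Nat.pos_of_ne_zero fun h0 => hn.ne' ?_
  obtain ⟨hmod, hdiv⟩ := Nat.add_eq_zero_iff.1 h0
  rw [← Nat.div_add_mod n q, hmod, hdiv, mul_zero]

theorem redExp_add_injOn {w : ℕ} : Set.InjOn (fun i => redExp q (i + w)) (Set.Iio (q - 1)) := by
  intro i hi j hj h
  have hmod : i + w ≡ j + w [MOD (q - 1)] :=
    (redExp_modEq q _).symm.trans (.trans (congrArg (· % (q - 1)) h) (redExp_modEq q _))
  exact (hmod.add_right_cancel' w).eq_of_lt_of_lt hi hj

theorem pow_redExp {F : Type*} [Field F] [Fintype F] (t : F) (n : ℕ) :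
    t ^ redExp (Fintype.card F) n = t ^ n := by
  rcases Nat.eq_zero_or_pos n with rfl | hn
  · simp [redExp]
  rcases eq_or_ne t 0 with rfl | ht
  · simp [redExp, hn.ne']
  rw [← pow_mod_orderOf, ← pow_mod_orderOf t n]
  exact congrArg (t ^ ·) ((redExp_modEq _ n).of_dvd
    (orderOf_dvd_of_pow_eq_one (FiniteField.pow_card_sub_one_eq_one t ht)))

end RedExp

section MonomialFun

variable {F σ : Type*} [Field F] [Fintype σ]

/-- The function on `σ → F` defined by the monomial with exponents `l`. -/
def monomialFun (F : Type*) [Field F] (l : σ → ℕ) : (σ → F) → F :=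
  fun a => ∏ k, a k ^ l k

variable [Fintype F]

theorem linearIndepOn_monomialFun :
    LinearIndepOn F (monomialFun F) {l : σ → ℕ | ∀ k, l k < Fintype.card F} := by
  classical
  rw [linearIndepOn_iff']
  intro s g hs hsum l hl
  set P : MvPolynomial σ F :=
    ∑ l ∈ s, MvPolynomial.monomial (Finsupp.equivFunOnFinite.symm l) (g l) with hP
  have hdeg : ∀ k, P.degreeOf k < Fintype.card F := fun k => by
    rw [MvPolynomial.degreeOf_lt_iff Fintype.card_pos]
    intro u hu
    obtain ⟨l, hl, hul⟩ := Finset.mem_biUnion.1 (MvPolynomial.support_sum hu)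
    obtain rfl := Finset.mem_singleton.1 (MvPolynomial.support_monomial_subset hul)
    exact hs hl k
  have hP0 : P = 0 := by
    refine MvPolynomial.eq_zero_of_eval_zero_at_prod_finset P (fun _ => Finset.univ) hdeg
      fun a _ => ?_
    rw [hP, map_sum, ← Pi.zero_apply (M := fun _ => F) a, ← hsum, Finset.sum_apply]
    refine Finset.sum_congr rfl fun l _ => ?_
    rw [MvPolynomial.eval_monomial, Finsupp.prod_fintype _ _ (by simp)]
    rfl
  have hcoeff : P.coeff (Finsupp.equivFunOnFinite.symm l) = g l := by
    simp [hP, MvPolynomial.coeff_sum, MvPolynomial.coeff_monomial, hl]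
  rw [← hcoeff, hP0, MvPolynomial.coeff_zero]

/-- The function on `F²` defined by `X ^ i Y ^ j`. The exponents form a pair rather than a
function on `Fin 2`, since the counting arguments treat the two coordinates differently. -/
def planeMonomial (F : Type*) [Field F] (ij : ℕ × ℕ) : (Fin 2 → F) → F :=
  monomialFun F ![ij.1, ij.2]

theorem planeMonomial_apply {F : Type*} [Field F] (ij : ℕ × ℕ) (x : Fin 2 → F) :
    planeMonomial F ij x = x 0 ^ ij.1 * x 1 ^ ij.2 := by
  simp [planeMonomial, monomialFun]

theorem linearIndepOn_planeMonomial :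
    LinearIndepOn F (planeMonomial F)
      ↑(Finset.range (Fintype.card F) ×ˢ Finset.range (Fintype.card F)) := by
  have hinj : Function.Injective fun ij : ℕ × ℕ => (![ij.1, ij.2] : Fin 2 → ℕ) :=
    fun u v huv => Prod.ext (congrFun huv 0) (congrFun huv 1)
  refine LinearIndepOn.comp_of_image (v := monomialFun F) (linearIndepOn_monomialFun.mono ?_)
    hinj.injOn
  rintro _ ⟨ij, hij, rfl⟩
  simpa [Fin.forall_fin_two] using hij

theorem finrank_span_planeMonomial {s : Finset (ℕ × ℕ)}
    (hs : s ⊆ Finset.range (Fintype.card F) ×ˢ Finset.range (Fintype.card F)) :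
    Module.finrank F (Submodule.span F (planeMonomial F '' s)) = s.card := by
  have h := linearIndepOn_planeMonomial.mono (Finset.coe_subset.2 hs)
  rw [Set.image_eq_range]
  exact (finrank_span_eq_card h).trans (Fintype.card_coe s)

theorem exists_sum_planeMonomial (v : (Fin 2 → F) → F) :
    ∃ f : ℕ × ℕ → F, ∑ ij ∈ Finset.range (Fintype.card F) ×ˢ Finset.range (Fintype.card F),
      f ij • planeMonomial F ij = v := by
  classical
  have htop : Submodule.span F (planeMonomial F ''
      ↑(Finset.range (Fintype.card F) ×ˢ Finset.range (Fintype.card F))) = ⊤ := by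
    apply Submodule.eq_top_of_finrank_eq
    rw [finrank_span_planeMonomial subset_rfl, Module.finrank_fintype_fun_eq_card]
    simp [sq]
  rw [← Submodule.mem_span_image_finset_iff_exists_fun', htop]
  exact Submodule.mem_top

end MonomialFun

section RSCode

variable {F : Type*} [Field F] {d s : ℕ}

theorem mem_RSCode_iff {v : F → F} :
    v ∈ RSCode F d ↔ ∃ g : Polynomial F, g.natDegree ≤ d ∧ ∀ t, v t = g.eval t := by
  simp only [RSCode, Submodule.mem_map, Polynomial.mem_degreeLE,
    ← Polynomial.natDegree_le_iff_degree_le]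
  exact exists_congr fun g => and_congr_right fun _ =>
    ⟨fun h t => (congrFun h t).symm, fun h => funext fun t => (h t).symm⟩

theorem pow_mem_RSCode (hs : s ≤ d) : (fun t : F => t ^ s) ∈ RSCode F d :=
  mem_RSCode_iff.2 ⟨Polynomial.X ^ s, (Polynomial.natDegree_X_pow_le s).trans hs, by simp⟩

theorem coeff_eq_zero_of_sum_mem_RSCode [Fintype F] {c : ℕ → F}
    (h : (fun t : F => ∑ s ∈ Finset.range (Fintype.card F), c s * t ^ s) ∈ RSCode F d)
    (hs : s < Fintype.card F) (hds : d < s) : c s = 0 := by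
  obtain ⟨g, hg, hv⟩ := mem_RSCode_iff.1 h
  set G : Polynomial F :=
    ∑ s ∈ Finset.range (Fintype.card F), Polynomial.C (c s) * Polynomial.X ^ s with hG
  have hGdeg : G.degree < Fintype.card F := by
    rw [← Polynomial.mem_degreeLT]
    refine Submodule.sum_mem _ fun s hs => Polynomial.mem_degreeLT.2 ?_
    exact (Polynomial.degree_C_mul_X_pow_le s (c s)).trans_lt
      (by exact_mod_cast Finset.mem_range.1 hs)
  have hgdeg : g.degree < Fintype.card F :=
    Polynomial.degree_le_natDegree.trans_lt (by exact_mod_cast hg.trans_lt (hds.trans hs))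
  have hGg : G = g := by
    refine Polynomial.eq_of_degrees_lt_of_eval_finset_eq Finset.univ
      (by simpa using hGdeg) (by simpa using hgdeg) fun t _ => ?_
    rw [← hv t, hG, Polynomial.eval_finsetSum]
    simp
  have hcoeff : G.coeff s = c s := by
    simp [hG, Polynomial.finsetSum_coeff, hs]
  rw [← hcoeff, hGg]
  exact Polynomial.coeff_eq_zero_of_natDegree_lt (hg.trans_lt hds)

end RSCode

section Curve

variable {F : Type*} [Field F] {η d : ℕ}

theorem eval_aeval_curve (f : MvPolynomial (Fin 2) F) (φ : Polynomial F) (t : F) :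
    (MvPolynomial.aeval ![Polynomial.X, φ] f : Polynomial F).eval t =
      MvPolynomial.eval ![t, φ.eval t] f := by
  rw [← Polynomial.coe_evalRingHom, MvPolynomial.aeval_def, MvPolynomial.hom_eval₂,
    MvPolynomial.eval, MvPolynomial.coe_eval₂Hom]
  congr 1
  · ext; simp
  · funext k
    fin_cases k <;> simp

theorem mem_liftRS_iff_curve [Finite F] {v : (Fin 2 → F) → F} :
    v ∈ liftRS F η d ↔ ∀ a : Fin (η + 1) → F,
      (fun t => v ![t, ∑ k, a k * t ^ (k : ℕ)]) ∈ RSCode F d := by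
  cases nonempty_fintype F
  rw [mem_liftRS]
  constructor
  · rintro ⟨f, hf, rfl⟩ a
    have := hf (∑ k : Fin (η + 1), Polynomial.C (a k) * Polynomial.X ^ (k : ℕ))
      (Polynomial.natDegree_sum_le_of_forall_le _ _ fun k _ =>
        (Polynomial.natDegree_C_mul_X_pow_le _ _).trans (by omega))
    simpa [eval_aeval_curve, Polynomial.eval_finsetSum] using this
  · intro h
    obtain ⟨f, rfl⟩ := exists_sum_planeMonomial v
    refine ⟨∑ ij ∈ Finset.range (Fintype.card F) ×ˢ Finset.range (Fintype.card F),
      MvPolynomial.C (f ij) * (MvPolynomial.X 0 ^ ij.1 * MvPolynomial.X 1 ^ ij.2),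
      fun φ hφ => ?_, by funext x; simp [planeMonomial_apply]⟩
    convert h fun k => φ.coeff k using 2 with t
    rw [eval_aeval_curve, Polynomial.eval_eq_sum_range' (Nat.lt_succ_of_le hφ), Finset.sum_range]
    simp [planeMonomial_apply]

end Curve

/-! ### The monomial basis of the lifted code -/

section ExpWeight

variable {η : ℕ}

/-- The exponent of `T` in the term with index `l` of the multinomial expansion of a power of
`∑ k, a k T ^ k`. -/
def expWeight (l : Fin (η + 1) → ℕ) : ℕ := ∑ k : Fin (η + 1), (k : ℕ) * l k

theorem expWeight_add (l l' : Fin (η + 1) → ℕ) :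
    expWeight (l + l') = expWeight l + expWeight l' := by
  simp [expWeight, mul_add, Finset.sum_add_distrib]

theorem expWeight_smul (n : ℕ) (l : Fin (η + 1) → ℕ) : expWeight (n • l) = n * expWeight l := by
  simp [expWeight, Finset.mul_sum, mul_left_comm]

theorem expWeight_single (k : Fin (η + 1)) (n : ℕ) : expWeight (Pi.single k n) = k * n := by
  simp [expWeight, Pi.single_apply]

end ExpWeight

/-- All the exponents of `T` that occur in `X ^ i Y ^ j` along a generic curve `Y = φ(X)` of
degree `η` over a field with `q` elements of characteristic `p` reduce to exponents at most `d`. -/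
def IsGoodExp (p η q d i j : ℕ) : Prop :=
  ∀ l : Fin (η + 1) → ℕ, CarryFree p l → ∑ k, l k = j → redExp q (i + expWeight l) ≤ d

open Classical in
/-- The exponents of the monomials spanning the lifted code. -/
noncomputable def goodExps (p η q d : ℕ) : Finset (ℕ × ℕ) :=
  {ij ∈ Finset.range q ×ˢ Finset.range q | IsGoodExp p η q d ij.1 ij.2}

theorem mem_goodExps {p η q d : ℕ} {ij : ℕ × ℕ} :
    ij ∈ goodExps p η q d ↔ (ij.1 < q ∧ ij.2 < q) ∧ IsGoodExp p η q d ij.1 ij.2 := by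
  simp [goodExps]

section CurveExpansion

variable {F : Type*} [Field F] {η : ℕ}

theorem mul_pow_curve (a : Fin (η + 1) → F) (t : F) (i j : ℕ) :
    t ^ i * (∑ k, a k * t ^ (k : ℕ)) ^ j =
      ∑ l ∈ Finset.piAntidiag Finset.univ j,
        (Nat.multinomial Finset.univ l : F) * monomialFun F l a * t ^ (i + expWeight l) := by
  rw [Finset.sum_pow_eq_sum_piAntidiag, Finset.mul_sum]
  refine Finset.sum_congr rfl fun l _ => ?_
  simp only [mul_pow, Finset.prod_mul_distrib, ← pow_mul, Finset.prod_pow_eq_pow_sum, pow_add,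
    expWeight, monomialFun]
  ring

/-- The sum of the coefficients of the monomials `X ^ i Y ^ j` whose expansion along a curve has
a term with index `l` and exponent of `T` reducing to `s`. -/
def fiberSum (q : ℕ) (f : ℕ × ℕ → F) (l : Fin (η + 1) → ℕ) (s : ℕ) : F :=
  ∑ i ∈ Finset.range q with redExp q (i + expWeight l) = s, f (i, ∑ k, l k)

/-- The indices of the terms in the expansions of `Y ^ j` along a curve for all `j < q`. -/
def curveExps (η q : ℕ) : Finset (Fin (η + 1) → ℕ) :=
  (Finset.range q).biUnion fun j => Finset.piAntidiag Finset.univ j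

theorem mem_curveExps {q : ℕ} {l : Fin (η + 1) → ℕ} : l ∈ curveExps η q ↔ ∑ k, l k < q := by
  simp [curveExps]

theorem sum_curveExps {M : Type*} [AddCommMonoid M] (q : ℕ) (g : (Fin (η + 1) → ℕ) → M) :
    ∑ l ∈ curveExps η q, g l =
      ∑ j ∈ Finset.range q, ∑ l ∈ Finset.piAntidiag Finset.univ j, g l := by
  rw [curveExps, Finset.sum_biUnion]
  intro j _ j' _ hjj'
  refine Finset.disjoint_left.2 fun l hl hl' => hjj' ?_
  simp only [Finset.mem_piAntidiag] at hl hl'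
  exact hl.1.symm.trans hl'.1

variable [Fintype F]

theorem sum_fiberSum_mul_pow (f : ℕ × ℕ → F) (l : Fin (η + 1) → ℕ) (t : F) :
    ∑ s ∈ Finset.range (Fintype.card F), fiberSum (Fintype.card F) f l s * t ^ s =
      ∑ i ∈ Finset.range (Fintype.card F), f (i, ∑ k, l k) * t ^ (i + expWeight l) := by
  have hmaps : ∀ i ∈ Finset.range (Fintype.card F),
      redExp (Fintype.card F) (i + expWeight l) ∈ Finset.range (Fintype.card F) :=
    fun i _ => Finset.mem_range.2 (redExp_lt Fintype.one_lt_card _)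
  refine .trans (Finset.sum_congr rfl fun s _ => ?_) (Finset.sum_fiberwise_of_maps_to hmaps _)
  rw [fiberSum, Finset.sum_mul]
  refine Finset.sum_congr rfl fun i hi => ?_
  rw [← (Finset.mem_filter.1 hi).2, pow_redExp]

theorem sum_planeMonomial_curve (f : ℕ × ℕ → F) (a : Fin (η + 1) → F) (t : F) :
    (∑ ij ∈ Finset.range (Fintype.card F) ×ˢ Finset.range (Fintype.card F),
        f ij • planeMonomial F ij) ![t, ∑ k, a k * t ^ (k : ℕ)] =
      ∑ s ∈ Finset.range (Fintype.card F), (∑ l ∈ curveExps η (Fintype.card F),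
        (Nat.multinomial Finset.univ l : F) * fiberSum (Fintype.card F) f l s *
          monomialFun F l a) * t ^ s := by
  calc
    _ = ∑ j ∈ Finset.range (Fintype.card F), ∑ i ∈ Finset.range (Fintype.card F),
        f (i, j) * (t ^ i * (∑ k, a k * t ^ (k : ℕ)) ^ j) := by
      simp [Finset.sum_product_right, planeMonomial_apply]
    _ = ∑ l ∈ curveExps η (Fintype.card F), (Nat.multinomial Finset.univ l : F) *
        monomialFun F l a * ∑ i ∈ Finset.range (Fintype.card F),
          f (i, ∑ k, l k) * t ^ (i + expWeight l) := by
      rw [sum_curveExps]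
      refine Finset.sum_congr rfl fun j _ => ?_
      simp only [mul_pow_curve, Finset.mul_sum]
      rw [Finset.sum_comm]
      refine Finset.sum_congr rfl fun l hl => Finset.sum_congr rfl fun i _ => ?_
      rw [(Finset.mem_piAntidiag.1 hl).1]
      ring
    _ = _ := by
      simp only [← sum_fiberSum_mul_pow, Finset.mul_sum, Finset.sum_mul]
      rw [Finset.sum_comm]
      exact Finset.sum_congr rfl fun s _ => Finset.sum_congr rfl fun l _ => by ring

end CurveExpansion

section Basis

variable {F : Type*} [Field F] [Fintype F] {p η d : ℕ} [CharP F p] {f : ℕ × ℕ → F}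

theorem fiberSum_eq_zero (hf : ∑ ij ∈ Finset.range (Fintype.card F) ×ˢ
      Finset.range (Fintype.card F), f ij • planeMonomial F ij ∈ liftRS F η d)
    {l : Fin (η + 1) → ℕ} (hl : CarryFree p l) (hlt : ∑ k, l k < Fintype.card F) {s : ℕ}
    (hs : s < Fintype.card F) (hds : d < s) : fiberSum (Fintype.card F) f l s = 0 := by
  have hcoeff : ∑ l ∈ curveExps η (Fintype.card F), ((Nat.multinomial Finset.univ l : F) *
      fiberSum (Fintype.card F) f l s) • monomialFun F l = 0 := by
    funext a
    have ha := mem_liftRS_iff_curve.1 hf a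
    simp only [sum_planeMonomial_curve] at ha
    simpa using coeff_eq_zero_of_sum_mem_RSCode ha hs hds
  have hindep : LinearIndepOn F (monomialFun F) (curveExps η (Fintype.card F) :
      Set (Fin (η + 1) → ℕ)) := linearIndepOn_monomialFun.mono fun l hl k =>
    (Finset.single_le_sum (f := l) (fun _ _ => Nat.zero_le _) (Finset.mem_univ k)).trans_lt
      (mem_curveExps.1 hl)
  have hprod : (Nat.multinomial Finset.univ l : F) * fiberSum (Fintype.card F) f l s = 0 :=
    linearIndepOn_finset_iff.1 hindep (fun l => (Nat.multinomial Finset.univ l : F) *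
      fiberSum (Fintype.card F) f l s) hcoeff l (mem_curveExps.2 hlt)
  exact (mul_eq_zero.1 hprod).resolve_left fun h => multinomial_cast_eq_zero_iff.1 h hl

theorem coeff_card_sub_one_eq_zero (hd : d + 1 < Fintype.card F)
    (hf : ∑ ij ∈ Finset.range (Fintype.card F) ×ˢ
      Finset.range (Fintype.card F), f ij • planeMonomial F ij ∈ liftRS F η d)
    {j : ℕ} (hj : j < Fintype.card F) : f (Fintype.card F - 1, j) = 0 := by
  obtain ⟨p, _⟩ := CharP.exists F
  have hp : 0 < p := Nat.pos_of_ne_zero (CharP.char_ne_zero_of_finite F p)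
  have hzero := fiberSum_eq_zero hf (carryFree_single hp (0 : Fin (η + 1)) j)
    (by simpa using hj) (s := Fintype.card F - 1) (by omega) (by omega)
  have hfiber : (Finset.range (Fintype.card F)).filter (fun i => redExp (Fintype.card F)
      (i + expWeight (Pi.single (0 : Fin (η + 1)) j)) = Fintype.card F - 1) =
      {Fintype.card F - 1} := by
    ext i
    simp only [expWeight_single, Fin.val_zero, zero_mul, add_zero, Finset.mem_filter,
      Finset.mem_range, Finset.mem_singleton]
    constructor
    · rintro ⟨hi, h⟩
      rwa [redExp_of_lt hi] at h
    · rintro rfl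
      exact ⟨by omega, redExp_of_lt (by omega)⟩
  simpa [fiberSum, hfiber] using hzero

theorem coeff_eq_zero_of_not_isGoodExp (hd : d + 1 < Fintype.card F)
    (hf : ∑ ij ∈ Finset.range (Fintype.card F) ×ˢ
      Finset.range (Fintype.card F), f ij • planeMonomial F ij ∈ liftRS F η d)
    {i j : ℕ} (hi : i < Fintype.card F) (hj : j < Fintype.card F)
    (hbad : ¬ IsGoodExp p η (Fintype.card F) d i j) : f (i, j) = 0 := by
  rcases eq_or_ne i (Fintype.card F - 1) with rfl | hne
  · exact coeff_card_sub_one_eq_zero hd hf hj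
  simp only [IsGoodExp, not_forall, not_le] at hbad
  obtain ⟨l, hl, rfl, hlt⟩ := hbad
  rw [← fiberSum_eq_zero hf hl hj (redExp_lt Fintype.one_lt_card _) hlt, fiberSum,
    Finset.sum_eq_single_of_mem i (by simpa using hi)]
  intro i' hi' hne'
  obtain ⟨hi', heq⟩ := Finset.mem_filter.1 hi'
  rw [Finset.mem_range] at hi'
  -- Shifted exponents collide after reduction only for `i'` or `i` equal to `q - 1`.
  rcases eq_or_ne i' (Fintype.card F - 1) with rfl | hlast
  · exact coeff_card_sub_one_eq_zero hd hf hj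
  · exact absurd (redExp_add_injOn (Set.mem_Iio.2 (by omega)) (Set.mem_Iio.2 (by omega)) heq) hne'

theorem planeMonomial_mem_liftRS {ij : ℕ × ℕ} (h : IsGoodExp p η (Fintype.card F) d ij.1 ij.2) :
    planeMonomial F ij ∈ liftRS F η d := by
  rw [mem_liftRS_iff_curve]
  intro a
  have hexpand : (fun t => planeMonomial F ij ![t, ∑ k, a k * t ^ (k : ℕ)]) =
      ∑ l ∈ Finset.piAntidiag Finset.univ ij.2,
        ((Nat.multinomial Finset.univ l : F) * monomialFun F l a) •
          fun t => t ^ redExp (Fintype.card F) (ij.1 + expWeight l) := by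
    funext t
    simp [planeMonomial_apply, mul_pow_curve, pow_redExp]
  rw [hexpand]
  refine Submodule.sum_mem _ fun l hl => ?_
  by_cases hcf : CarryFree p l
  · exact Submodule.smul_mem _ _ (pow_mem_RSCode (h l hcf (Finset.mem_piAntidiag.1 hl).1))
  · rw [multinomial_cast_eq_zero_iff.2 hcf, zero_mul, zero_smul]
    exact Submodule.zero_mem _

theorem liftRS_eq_span (hd : d + 1 < Fintype.card F) :
    liftRS F η d = Submodule.span F (planeMonomial F '' goodExps p η (Fintype.card F) d) := by
  apply le_antisymm
  · intro v hv
    obtain ⟨f, rfl⟩ := exists_sum_planeMonomial v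
    refine Submodule.sum_mem _ fun ij hij => ?_
    rw [Finset.mem_product, Finset.mem_range, Finset.mem_range] at hij
    by_cases hgood : IsGoodExp p η (Fintype.card F) d ij.1 ij.2
    · exact Submodule.smul_mem _ _ (Submodule.subset_span
        (Set.mem_image_of_mem _ (mem_goodExps.2 ⟨hij, hgood⟩)))
    · rw [show f ij = 0 from coeff_eq_zero_of_not_isGoodExp hd hv hij.1 hij.2 hgood, zero_smul]
      exact Submodule.zero_mem _
  · rw [Submodule.span_le]
    rintro _ ⟨ij, hij, rfl⟩
    exact planeMonomial_mem_liftRS (mem_goodExps.1 hij).2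

theorem finrank_liftRS (hd : d + 1 < Fintype.card F) :
    Module.finrank F (liftRS F η d) = (goodExps p η (Fintype.card F) d).card := by
  rw [liftRS_eq_span (p := p) hd, finrank_span_planeMonomial]
  intro ij hij
  simpa using (mem_goodExps.1 hij).1

end Basis

/-! ### A lower bound for the number of good exponents -/

section LowWeight

variable {p η q B D i j : ℕ}

/-- The weight `u + η v` of the residues `u`, `v` modulo `B` of a pair of exponents. -/
def lowWeight (η B : ℕ) (ij : ℕ × ℕ) : ℕ := ij.1 % B + η * (ij.2 % B)

theorem lowWeight_mul (η B B' : ℕ) (ij : ℕ × ℕ) :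
    lowWeight η (B * B') ij = lowWeight η B ij + B * lowWeight η B' (ij.1 / B, ij.2 / B) := by
  simp only [lowWeight, Nat.mod_mul]
  ring

theorem lowWeight_mul_lt_iff {B' : ℕ} {ij : ℕ × ℕ} (h : lowWeight η B ij < B) :
    lowWeight η (B * B') ij < B * B' ↔ lowWeight η B' (ij.1 / B, ij.2 / B) < B' := by
  rw [lowWeight_mul]
  constructor <;> intro hlt
  · exact Nat.lt_of_mul_lt_mul_left ((Nat.le_add_left _ _).trans_lt hlt)
  · have := Nat.mul_le_mul_left B (Nat.succ_le_of_lt hlt)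
    rw [Nat.mul_succ] at this
    omega

theorem expWeight_add_sum_sub_mul (l : Fin (η + 1) → ℕ) :
    expWeight l + ∑ k : Fin (η + 1), (η - k) * l k = η * ∑ k, l k := by
  rw [Finset.mul_sum, expWeight, ← Finset.sum_add_distrib]
  exact Finset.sum_congr rfl fun k _ => by rw [← add_mul, Nat.add_sub_cancel' (by omega)]

theorem expWeight_le (l : Fin (η + 1) → ℕ) : expWeight l ≤ η * ∑ k, l k :=
  expWeight_add_sum_sub_mul l ▸ Nat.le_add_right _ _

theorem add_expWeight_div_le {l : Fin (η + 1) → ℕ} (hi : i < q) (hl : ∑ k, l k < q) :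
    (i + expWeight l) / q ≤ η := by
  have hweight := (expWeight_le l).trans (Nat.mul_le_mul_left η hl.le)
  rw [← Nat.lt_succ_iff, Nat.div_lt_iff_lt_mul (by omega), Nat.succ_mul]
  omega

theorem add_expWeight_mod_le {m : ℕ} {l : Fin (η + 1) → ℕ} (hl : CarryFree p l) :
    (i + expWeight l) % p ^ m ≤ lowWeight η (p ^ m) (i, ∑ k, l k) := by
  have hmod : i + expWeight l ≡ i % p ^ m + expWeight (fun k => l k % p ^ m) [MOD p ^ m] :=
    .add (Nat.mod_modEq _ _).symm (.sum fun k _ => .mul_left _ (Nat.mod_modEq _ _).symm)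
  refine (hmod.trans_le (Nat.mod_le _ _)).trans (Nat.add_le_add_left ?_ _)
  rw [← hl.sum_mod]
  exact expWeight_le _

theorem mod_add_le_add_mod (hq : 0 < q) (hB : B ∣ q) (n : ℕ) : n % q + B ≤ q + n % B := by
  obtain ⟨k, rfl⟩ := hB
  have hdigit := Nat.mul_le_mul_left B
    (Nat.succ_le_of_lt (Nat.mod_lt (n / B) (Nat.pos_of_mul_pos_left hq)))
  rw [Nat.mul_succ] at hdigit
  rw [Nat.mod_mul]
  omega

theorem isGoodExp_of_lowWeight_le {m : ℕ} (hm : p ^ m ∣ q) (hD : 0 < D) (hi : i < q) (hj : j < q)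
    (h : lowWeight η (p ^ m) (i, j) + D + η ≤ p ^ m) : IsGoodExp p η q (q - D) i j := by
  rintro l hl rfl
  have hdiv := add_expWeight_div_le hi hj
  have hlow := add_expWeight_mod_le (m := m) (i := i) hl
  have hmod := mod_add_le_add_mod (by omega) hm (i + expWeight l)
  rw [redExp_eq_mod_add_div (by omega)]
  omega

end LowWeight

section Blocks

variable {η A B : ℕ} {ij : ℕ × ℕ}

/-- The lattice points of the triangle `u + η v < A`. -/
def triangle (η A : ℕ) : Finset (ℕ × ℕ) :=
  {uv ∈ Finset.range A ×ˢ Finset.range A | uv.1 + η * uv.2 < A}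

theorem mem_triangle (hη : 0 < η) : ij ∈ triangle η A ↔ ij.1 + η * ij.2 < A := by
  have : ij.2 ≤ η * ij.2 := Nat.le_mul_of_pos_left _ hη
  simp only [triangle, Finset.mem_filter, Finset.mem_product, Finset.mem_range]
  omega

theorem triangle_subset (hAB : A ≤ B) : triangle η A ⊆ Finset.range B ×ˢ Finset.range B :=
  (Finset.filter_subset _ _).trans
    (Finset.product_subset_product (Finset.range_mono hAB) (Finset.range_mono hAB))

theorem card_triangle_eq_sum (hη : 0 < η) (hA : 0 < A) :
    (triangle η A).card = ∑ v ∈ Finset.range ((A - 1) / η + 1), (A - η * v) := by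
  rw [Finset.card_eq_sum_card_fiberwise (f := Prod.snd)
    (t := Finset.range ((A - 1) / η + 1)) fun uv huv => ?_]
  · refine Finset.sum_congr rfl fun v _ => ?_
    rw [← Finset.card_range (A - η * v)]
    refine Finset.card_nbij' Prod.fst (fun u => (u, v)) ?_ ?_ ?_ ?_ <;>
      grind [mem_triangle, Set.MapsTo, Set.LeftInvOn]
  · have := (mem_triangle hη).1 huv
    rw [Finset.coe_range, Set.mem_Iio, Nat.lt_succ_iff, Nat.le_div_iff_mul_le hη, mul_comm]
    omega

theorem card_triangle (hη : 0 < η) (hA : 0 < A) :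
    ((triangle η A).card : ℝ) =
      (((A - 1) / η : ℕ) + 1) * ((A : ℝ) - (η : ℝ) / 2 * ((A - 1) / η : ℕ)) := by
  have hsum (n : ℕ) : ∑ v ∈ Finset.range (n + 1), ((A : ℝ) - η * v) =
      (n + 1) * (A - η / 2 * n) := by
    induction n with
    | zero => simp
    | succ n ih => rw [Finset.sum_range_succ, ih]; push_cast; ring
  rw [card_triangle_eq_sum hη hA, Nat.cast_sum, ← hsum]
  refine Finset.sum_congr rfl fun v hv => ?_
  rw [Finset.mem_range, Nat.lt_succ_iff, Nat.le_div_iff_mul_le hη, mul_comm] at hv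
  rw [Nat.cast_sub (by omega), Nat.cast_mul]

theorem le_card_triangle (hη : 0 < η) (hA : 0 < A) :
    ((A : ℝ) - 1) ^ 2 / (2 * η) ≤ (triangle η A).card := by
  rw [card_triangle hη hA]
  set V := (A - 1) / η with hV
  obtain ⟨r, hr, hAr⟩ : ∃ r, r < η ∧ A = η * V + r + 1 :=
    ⟨(A - 1) % η, Nat.mod_lt _ hη, by rw [hV, Nat.div_add_mod]; omega⟩
  have hη0 : (0 : ℝ) < η := by exact_mod_cast hη
  have hr' : (r : ℝ) ≤ η := by exact_mod_cast hr.le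
  have hV0 : (0 : ℝ) ≤ V := Nat.cast_nonneg _
  have hr0 : (0 : ℝ) ≤ r := Nat.cast_nonneg _
  rw [hAr, div_le_iff₀ (by positivity)]
  push_cast
  nlinarith [mul_nonneg hr0 (sub_nonneg.2 hr'), mul_nonneg hη0.le hV0,
    mul_nonneg hη0.le (mul_nonneg hη0.le hV0), mul_nonneg hη0.le hr0]

/-- The pairs whose quotients by `B` lie in `N` and whose residues modulo `B` lie in `Z`. -/
def blockPairs (B : ℕ) (N Z : Finset (ℕ × ℕ)) : Finset (ℕ × ℕ) :=
  (N ×ˢ Z).image fun x => (B * x.1.1 + x.2.1, B * x.1.2 + x.2.2)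

variable {N Z : Finset (ℕ × ℕ)}

theorem div_mod_blockPair {z : ℕ × ℕ} (hz : z ∈ Finset.range B ×ˢ Finset.range B) (n : ℕ × ℕ) :
    ((B * n.1 + z.1) / B, (B * n.2 + z.2) / B) = n ∧
      ((B * n.1 + z.1) % B, (B * n.2 + z.2) % B) = z := by
  simp only [Finset.mem_product, Finset.mem_range] at hz
  simp [Nat.mul_add_div (Nat.zero_lt_of_lt hz.1), Nat.mod_eq_of_lt, Nat.div_eq_of_lt, hz]

theorem mem_blockPairs (hZ : Z ⊆ Finset.range B ×ˢ Finset.range B) :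
    ij ∈ blockPairs B N Z ↔ (ij.1 / B, ij.2 / B) ∈ N ∧ (ij.1 % B, ij.2 % B) ∈ Z := by
  simp only [blockPairs, Finset.mem_image, Finset.mem_product]
  constructor
  · rintro ⟨⟨n, z⟩, ⟨hn, hz⟩, rfl⟩
    obtain ⟨hdiv, hmod⟩ := div_mod_blockPair (hZ hz) n
    exact ⟨hdiv.symm ▸ hn, hmod.symm ▸ hz⟩
  · rintro ⟨hn, hz⟩
    exact ⟨((ij.1 / B, ij.2 / B), (ij.1 % B, ij.2 % B)), ⟨hn, hz⟩,
      Prod.ext (Nat.div_add_mod _ _) (Nat.div_add_mod _ _)⟩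

theorem card_blockPairs (hZ : Z ⊆ Finset.range B ×ˢ Finset.range B) :
    (blockPairs B N Z).card = N.card * Z.card := by
  rw [blockPairs, Finset.card_image_of_injOn, Finset.card_product]
  refine Set.LeftInvOn.injOn (f₁' := fun ij => ((ij.1 / B, ij.2 / B), (ij.1 % B, ij.2 % B))) ?_
  rintro ⟨n, z⟩ hx
  obtain ⟨hdiv, hmod⟩ := div_mod_blockPair (hZ (Finset.mem_product.1 hx).2) n
  exact Prod.ext hdiv hmod

end Blocks

section Levels

variable {b η m ν a A : ℕ} {ij : ℕ × ℕ}

/-- The number of low base-`b` digits in the largest part of a pair of `m`-digit exponents that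
lies below the line `u + η v = b ^ k`. -/
def level (b η m : ℕ) (ij : ℕ × ℕ) : ℕ :=
  Nat.findGreatest (fun k => lowWeight η (b ^ k) ij < b ^ k) m

/-- The pairs of `m`-digit numbers in base `b` of which no nonempty low part lies below the line
`u + η v = b ^ k`. They are counted by `N_m`. -/
def primPairs (b η m : ℕ) : Finset (ℕ × ℕ) :=
  {ij ∈ Finset.range (b ^ m) ×ˢ Finset.range (b ^ m) |
    ∀ k ∈ Finset.Icc 1 m, b ^ k ≤ lowWeight η (b ^ k) ij}

theorem mem_blockPairs_primPairs_triangle (hb : 0 < b) (hη : 0 < η) (hA : A ≤ b ^ a) :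
    ij ∈ blockPairs (b ^ a) (primPairs b η ν) (triangle η A) ↔
      ij ∈ Finset.range (b ^ (a + ν)) ×ˢ Finset.range (b ^ (a + ν)) ∧
        lowWeight η (b ^ a) ij < A ∧ level b η (a + ν) ij = a := by
  have hprim (hlow : lowWeight η (b ^ a) ij < b ^ a) :
      (∀ k ∈ Finset.Icc 1 ν, b ^ k ≤ lowWeight η (b ^ k) (ij.1 / b ^ a, ij.2 / b ^ a)) ↔
        ∀ k, a < k → k ≤ a + ν → b ^ k ≤ lowWeight η (b ^ k) ij := by
    have hk (k : ℕ) := lowWeight_mul_lt_iff (B' := b ^ k) hlow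
    simp only [← pow_add, ← not_le, not_iff_not] at hk
    simp only [Finset.mem_Icc, ← hk]
    constructor <;> intro h k
    · intro h1 h2
      simpa [h1.le] using h (k - a) (by omega)
    · exact fun hk => h _ (by omega) (by omega)
  have hpow : b ^ (a + ν) = b ^ ν * b ^ a := by rw [pow_add, mul_comm]
  rw [mem_blockPairs (triangle_subset hA), mem_triangle hη, level, Nat.findGreatest_eq_iff,
    primPairs, Finset.mem_filter, Finset.mem_product, Finset.mem_product]
  simp only [Finset.mem_range, not_lt, hpow, Nat.div_lt_iff_lt_mul (pow_pos hb a)]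
  constructor
  · rintro ⟨⟨hlt, h⟩, hlow⟩
    have hlow' := hlow.trans_le hA
    exact ⟨hlt, hlow, Nat.le_add_right _ _, fun _ => hlow', (hprim hlow').1 h⟩
  · rintro ⟨hlt, hlow, -, -, h⟩
    exact ⟨⟨hlt, (hprim (hlow.trans_le hA)).2 h⟩, hlow⟩

theorem sum_card_primPairs_mul (hb : 0 < b) (hη : 0 < η) (m : ℕ) :
    ∑ ν ∈ Finset.range (m + 1), (primPairs b η ν).card * (triangle η (b ^ (m - ν))).card =
      b ^ (2 * m) := by
  have hfiber := Finset.card_eq_sum_card_fiberwise (f := fun ij => m - level b η m ij)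
    (s := Finset.range (b ^ m) ×ˢ Finset.range (b ^ m)) (t := Finset.range (m + 1))
    fun ij _ => by simp [Nat.lt_succ_of_le (Nat.sub_le _ _)]
  rw [Finset.card_product, Finset.card_range, ← pow_add, ← two_mul] at hfiber
  rw [hfiber]
  refine Finset.sum_congr rfl fun ν hν => ?_
  rw [← card_blockPairs (triangle_subset le_rfl)]
  congr 1
  ext ij
  rw [Finset.mem_range] at hν
  have hspec : lowWeight η (b ^ level b η m ij) ij < b ^ level b η m ij :=
    Nat.findGreatest_spec (P := fun k => lowWeight η (b ^ k) ij < b ^ k) (Nat.zero_le m)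
      (by simp [lowWeight, Nat.mod_one])
  have hle : level b η m ij ≤ m := Nat.findGreatest_le m
  rw [mem_blockPairs_primPairs_triangle hb hη le_rfl, Finset.mem_filter,
    Nat.sub_add_cancel (by omega)]
  refine and_congr_right fun _ => ⟨fun h => by omega, fun h => ?_⟩
  have hlevel : level b η m ij = m - ν := by omega
  exact ⟨hlevel ▸ hspec, hlevel⟩

theorem seqT_eq_card_triangle (hb : 0 < b) (hη : 0 < η) (m : ℕ) :
    seqT b η m = (triangle η (b ^ m)).card := by
  rw [card_triangle hη (pow_pos hb m), seqT, Nat.cast_pow]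

theorem seqN_eq_card_primPairs (hb : 0 < b) (hη : 0 < η) (m : ℕ) :
    seqN b η m = (primPairs b η m).card := by
  induction m using Nat.strong_induction_on with
  | _ m ih =>
    have htriangle : (triangle η 1).card = 1 := by
      simpa using card_triangle hη one_pos
    have hsum : (b : ℝ) ^ (2 * m) = (∑ ν ∈ Finset.range m, ((primPairs b η ν).card : ℝ) *
        (triangle η (b ^ (m - ν))).card) + (primPairs b η m).card := by
      have h := sum_card_primPairs_mul hb hη m
      rw [Finset.sum_range_succ, Nat.sub_self, pow_zero, htriangle, mul_one] at h
      exact_mod_cast h.symm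
    cases m with
    | zero => simpa [seqN] using hsum
    | succ m =>
      rw [seqN, hsum, Finset.sum_range, sub_eq_iff_eq_add, add_comm, add_right_inj]
      exact Finset.sum_congr rfl fun ν _ => by rw [ih ν ν.2, seqT_eq_card_triangle hb hη]

theorem sum_card_le_card_goodExps {p s c e : ℕ} (hb : b = p ^ s) (hb0 : 0 < b) (hη : 0 < η)
    (hce : c ≤ e) :
    ∑ ν ∈ Finset.range c,
        (primPairs b η ν).card * (triangle η (b ^ (e - ν) - b ^ (e - c) - η)).card ≤
      (goodExps p η (b ^ e) (b ^ e - b ^ (e - c))).card := by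
  have hA (ν : ℕ) : b ^ (e - ν) - b ^ (e - c) - η ≤ b ^ (e - ν) := by omega
  calc
    _ = ∑ ν ∈ Finset.range c, (blockPairs (b ^ (e - ν)) (primPairs b η ν)
        (triangle η (b ^ (e - ν) - b ^ (e - c) - η))).card :=
      Finset.sum_congr rfl fun ν _ => (card_blockPairs (triangle_subset (hA ν))).symm
    _ ≤ ∑ ν ∈ Finset.range c, ((goodExps p η (b ^ e) (b ^ e - b ^ (e - c))).filter
        fun ij => e - level b η e ij = ν).card := by
      refine Finset.sum_le_sum fun ν hν => Finset.card_le_card fun ij hij => ?_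
      rw [Finset.mem_range] at hν
      rw [mem_blockPairs_primPairs_triangle hb0 hη (hA ν), Nat.sub_add_cancel (by omega)] at hij
      obtain ⟨hmem, hlow, hlevel⟩ := hij
      simp only [Finset.mem_product, Finset.mem_range] at hmem
      refine Finset.mem_filter.2 ⟨mem_goodExps.2 ⟨hmem, ?_⟩, by omega⟩
      refine isGoodExp_of_lowWeight_le (m := s * (e - ν)) ?_ (pow_pos hb0 _) hmem.1 hmem.2 ?_
      · rw [pow_mul, ← hb]
        exact pow_dvd_pow b (Nat.sub_le e ν)
      · rw [pow_mul, ← hb, Prod.mk.eta]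
        omega
    _ ≤ _ := by
      rw [Finset.sum_card_fiberwise_eq_card_filter]
      exact Finset.card_filter_le _ _

end Levels

/-! ### Convergence of the density of good exponents -/

section CarryFreeMoves

variable {κ : Type*} [Fintype κ] [DecidableEq κ] {p t : ℕ} {l : κ → ℕ}

theorem CarryFree.smul_add_single (hl : CarryFree p l) {b : ℕ} (hb : b < p) (k : κ) :
    CarryFree p (p • l + Pi.single k b) := by
  rintro (_ | m)
  · simp [Nat.mod_one]
  have hmod (x : κ) : (p • l + Pi.single k b : κ → ℕ) x % p ^ (m + 1) =
      p * (l x % p ^ m) + (Pi.single k b : κ → ℕ) x := by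
    have hx : (Pi.single k b : κ → ℕ) x < p := by
      rw [Pi.single_apply]
      split_ifs <;> omega
    rw [pow_succ', Nat.mod_mul, Pi.add_apply, Pi.smul_apply, smul_eq_mul, Nat.mul_add_mod,
      Nat.mod_eq_of_lt hx, Nat.mul_add_div (by omega), Nat.div_eq_of_lt hx, add_zero, add_comm]
  have hsum := Nat.mul_le_mul_left p (Nat.succ_le_of_lt (hl m))
  rw [Nat.mul_succ] at hsum
  rw [Finset.sum_congr rfl fun x _ => hmod x, Finset.sum_add_distrib, ← Finset.mul_sum, pow_succ',
    Fintype.sum_pi_single']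
  omega

theorem CarryFree.of_add_single_eq (hl : CarryFree p l) {l' : κ → ℕ} {k k' : κ} (hkk' : k ≠ k')
    (h : l' + Pi.single k (p ^ t) = l + Pi.single k' (p ^ t))
    (hk : ∀ m, t < m → p ^ t ≤ l k % p ^ m) : CarryFree p l' := by
  intro m
  have hx (x : κ) := congrFun h x
  simp only [Pi.add_apply] at hx
  rcases le_or_gt m t with hm | hm
  · have hzero (k x : κ) : (Pi.single k (p ^ t) : κ → ℕ) x ≡ 0 [MOD p ^ m] := by
      rw [Nat.modEq_zero_iff_dvd, Pi.single_apply]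
      split_ifs
      exacts [pow_dvd_pow p hm, dvd_zero _]
    have hmod (x : κ) : l' x ≡ l x [MOD p ^ m] :=
      ((hzero k x).add_left (l' x)).symm.trans (hx x ▸ (hzero k' x).add_left (l x))
    rw [Finset.sum_congr rfl fun x _ => hmod x]
    exact hl m
  · have hmod (x : κ) : l' x % p ^ m + (Pi.single k (p ^ t) : κ → ℕ) x ≤
        l x % p ^ m + (Pi.single k' (p ^ t) : κ → ℕ) x := by
      rcases eq_or_ne x k with rfl | hxk
      · have hsub : l' x = l x - p ^ t := by simpa [hkk'] using Nat.eq_sub_of_add_eq (hx x)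
        rw [hsub, ← Nat.mod_sub_of_le (hk m hm)]
        simp [hkk', hk m hm]
      · specialize hx x
        rw [Pi.single_eq_of_ne hxk, add_zero] at hx ⊢
        rw [hx, Nat.add_mod]
        exact (Nat.mod_le _ _).trans (Nat.add_le_add_left (Nat.mod_le _ _) _)
    have hsum := Finset.sum_le_sum fun x (_ : x ∈ Finset.univ) => hmod x
    simp only [Finset.sum_add_distrib, Fintype.sum_pi_single'] at hsum
    exact (Nat.le_of_add_le_add_right hsum).trans_lt (hl m)

theorem CarryFree.exists_expWeight_eq_add {η : ℕ} {l : Fin (η + 1) → ℕ} (hl : CarryFree p l)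
    {k : Fin (η + 1)} (hk : (k : ℕ) < η) (hdigit : ∀ m, t < m → p ^ t ≤ l k % p ^ m) :
    ∃ l' : Fin (η + 1) → ℕ, CarryFree p l' ∧ ∑ k, l' k = ∑ k, l k ∧
      expWeight l' = expWeight l + p ^ t := by
  set k' : Fin (η + 1) := ⟨k + 1, by omega⟩
  have hkk' : k ≠ k' := fun h => absurd (congrArg Fin.val h) (Nat.lt_succ_self _).ne
  have hle : Pi.single k (p ^ t) ≤ l + Pi.single k' (p ^ t) := by
    intro x
    rcases eq_or_ne x k with rfl | hx
    · simpa [Pi.single_eq_of_ne hkk'] using (hdigit _ t.lt_succ_self).trans (Nat.mod_le _ _)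
    · simp [hx]
  have hmove := tsub_add_cancel_of_le hle
  refine ⟨_, hl.of_add_single_eq hkk' hmove hdigit, ?_, ?_⟩
  · have hsum := congrArg (fun l => ∑ k, l k) hmove
    simpa [Finset.sum_add_distrib] using hsum
  · have hweight := congrArg expWeight hmove
    rw [expWeight_add, expWeight_add, expWeight_single, expWeight_single,
      show (k' : ℕ) = k + 1 from rfl, add_mul, one_mul, ← add_assoc, add_right_comm] at hweight
    exact Nat.add_right_cancel hweight

theorem exists_pow_le_mod {x s n : ℕ} (hp : 1 < p) (h : p ^ s ≤ x % p ^ n) :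
    ∃ t, s ≤ t ∧ t < n ∧ ∀ m, t < m → p ^ t ≤ x % p ^ m := by
  have hne : x % p ^ n ≠ 0 := ((pow_pos (by omega) s).trans_le h).ne'
  refine ⟨Nat.log p (x % p ^ n), Nat.le_log_of_pow_le hp h,
    Nat.log_lt_of_lt_pow hne (Nat.mod_lt _ (by positivity)), fun m hm => ?_⟩
  refine (Nat.pow_log_le_self p hne).trans ?_
  rcases le_or_gt m n with hmn | hmn
  · have hlt : x % p ^ n < p ^ m :=
      (Nat.lt_pow_succ_log_self hp _).trans_le (Nat.pow_le_pow_right (by omega) hm)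
    rw [← Nat.mod_mod_of_dvd x (pow_dvd_pow p hmn), Nat.mod_eq_of_lt hlt]
  · rw [← Nat.mod_mod_of_dvd x (pow_dvd_pow p hmn.le)]
    exact Nat.mod_le _ _

end CarryFreeMoves

section StablyBad

variable {p η q N i j : ℕ}

/-- A form of badness of an exponent pair for the degree `q - N` that persists when digits are
appended: some exponent of `T` along a generic curve has a residue modulo `q` that exceeds `q - N`,
and its reduction causes no carry. -/
def IsStablyBad (p η q N i j : ℕ) : Prop :=
  ∃ l : Fin (η + 1) → ℕ, CarryFree p l ∧ ∑ k, l k = j ∧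
    q < (i + expWeight l) % q + N ∧ (i + expWeight l) % q + (i + expWeight l) / q < q

theorem IsStablyBad.not_isGoodExp (h : IsStablyBad p η q N i j) (hN : N ≤ q) :
    ¬ IsGoodExp p η q (q - N) i j := by
  obtain ⟨l, hl, hsum, hlt, hcarry⟩ := h
  intro hgood
  have := hgood l hl hsum
  rw [redExp_eq_mod_add_div hcarry] at this
  have hdiv : 0 ≤ (i + expWeight l) / q := Nat.zero_le _
  omega

theorem IsStablyBad.append {a b : ℕ} (h : IsStablyBad p η q N i j) (ha : a < p) (hb : b < p) :
    IsStablyBad p η (p * q) (p * N) (p * i + a) (p * j + b) := by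
  obtain ⟨l, hl, hsum, hlt, hcarry⟩ := h
  have hS : p * i + a + expWeight (p • l + Pi.single 0 b) = p * (i + expWeight l) + a := by
    rw [expWeight_add, expWeight_smul, expWeight_single, Fin.val_zero]
    ring
  have hp : 0 < p := by omega
  refine ⟨p • l + Pi.single 0 b, hl.smul_add_single hb 0, ?_, ?_⟩
  · simp [Finset.sum_add_distrib, ← Finset.mul_sum, hsum]
  rw [hS, Nat.mod_mul, ← Nat.div_div_eq_div_mul, Nat.mul_add_mod, Nat.mod_eq_of_lt ha,
    Nat.mul_add_div hp, Nat.div_eq_of_lt ha, add_zero]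
  have hlt' := Nat.mul_lt_mul_of_pos_left hlt hp
  have hcarry' := Nat.mul_le_mul_left p (Nat.succ_le_of_lt hcarry)
  have hdiv := Nat.le_mul_of_pos_left ((i + expWeight l) / q) hp
  rw [Nat.mul_add] at hlt'
  rw [Nat.mul_succ, Nat.mul_add] at hcarry'
  omega

theorem redExp_le_div {n : ℕ} (hn : n / q < q) (h : q ≤ n % q + n / q) : redExp q n ≤ n / q := by
  have hmod : n % q < q := Nat.mod_lt _ (Nat.zero_lt_of_lt hn)
  have hmodEq : n ≡ n % q + n / q - (q - 1) [MOD (q - 1)] :=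
    (add_div_modEq_pred q n).symm.trans (Nat.mod_eq_sub_mod (by omega))
  have hpos : 0 < n := Nat.pos_of_ne_zero fun h0 => by simp [h0] at h; omega
  rw [redExp_eq_of_modEq hmodEq hpos (by omega) (by omega)]
  omega

theorem mod_pow_lt_of_not_isStablyBad {n : ℕ} (hp : 1 < p) (hN : N = p ^ n)
    (hbad : ¬ IsStablyBad p η q N i j) {l : Fin (η + 1) → ℕ} (hl : CarryFree p l)
    (hsum : ∑ k, l k = j) (hdiv : (i + expWeight l) / q ≤ η)
    (hlow : (i + expWeight l) % q + N ≤ q)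
    (hhigh : q < (i + expWeight l) % q + (i + expWeight l) / q + N)
    {k : Fin (η + 1)} (hk : (k : ℕ) < η) : l k % N < p ^ η := by
  by_contra! hge
  obtain ⟨t, hηt, htn, hdigit⟩ := exists_pow_le_mod hp (hN ▸ hge)
  obtain ⟨l', hl', hsum', hweight⟩ := hl.exists_expWeight_eq_add hk hdigit
  have hηt' : η < p ^ t := (Nat.lt_pow_self hp).trans_le (Nat.pow_le_pow_right (by omega) hηt)
  have htN : 2 * p ^ t ≤ N := calc
    2 * p ^ t ≤ p * p ^ t := Nat.mul_le_mul_right _ hp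
    _ = p ^ (t + 1) := (pow_succ' _ _).symm
    _ ≤ N := hN ▸ Nat.pow_le_pow_right (by omega) htn
  have hmod_lt : (i + expWeight l) % q + p ^ t < q := by omega
  have hS : i + expWeight l' =
      q * ((i + expWeight l) / q) + ((i + expWeight l) % q + p ^ t) := by
    rw [hweight, ← add_assoc, ← add_assoc, Nat.div_add_mod]
  refine hbad ⟨l', hl', hsum'.trans hsum, ?_⟩
  rw [hS, Nat.mul_add_mod, Nat.mod_eq_of_lt hmod_lt, Nat.mul_add_div (by omega),
    Nat.div_eq_of_lt hmod_lt, add_zero]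
  omega

/-- The bound, coming from `mod_pow_lt_of_not_isStablyBad`, for the residue modulo `N` of
`i + η j + η` when `(i, j)` is neither good nor stably bad. -/
def exceptionalBound (p η : ℕ) : ℕ := η + (η + 1) * (η * p ^ η) + 1

theorem sum_sub_mul_mod_le {l : Fin (η + 1) → ℕ} {P : ℕ}
    (h : ∀ k : Fin (η + 1), (k : ℕ) < η → l k % N < P) :
    ∑ k : Fin (η + 1), (η - k) * (l k % N) ≤ (η + 1) * (η * P) := by
  have hterm (k : Fin (η + 1)) : (η - (k : ℕ)) * (l k % N) ≤ η * P := by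
    rcases lt_or_ge (k : ℕ) η with hk | hk
    · exact Nat.mul_le_mul (Nat.sub_le _ _) (h k hk).le
    · simp [Nat.sub_eq_zero_of_le hk]
  simpa using Finset.sum_le_card_nsmul Finset.univ _ _ fun k _ => hterm k

theorem mod_lt_exceptionalBound {n : ℕ} (hp : 1 < p) (hN : N = p ^ n) (hNq : N ∣ q)
    (hN2 : 2 * N ≤ q) (hηN : η < N) (hi : i < q) (hj : j < q)
    (hgood : ¬ IsGoodExp p η q (q - N) i j) (hbad : ¬ IsStablyBad p η q N i j) :
    (i + (η * j + η)) % N < exceptionalBound p η := by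
  simp only [IsGoodExp, not_forall, not_le] at hgood
  obtain ⟨l, hl, hsum, hlt⟩ := hgood
  have hdiv : (i + expWeight l) / q ≤ η := add_expWeight_div_le hi (hsum.trans_lt hj)
  have hcarry : (i + expWeight l) % q + (i + expWeight l) / q < q := by
    by_contra! hge
    have := redExp_le_div (by omega) hge
    omega
  rw [redExp_eq_mod_add_div hcarry] at hlt
  have hlow : (i + expWeight l) % q + N ≤ q := by
    by_contra! h
    exact hbad ⟨l, hl, hsum, h, hcarry⟩
  have hdigits := sum_sub_mul_mod_le fun k =>
    mod_pow_lt_of_not_isStablyBad hp hN hbad hl hsum hdiv hlow (by omega) (k := k)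
  have hsplit : i + (η * j + η) =
      i + expWeight l + η + ∑ k : Fin (η + 1), (η - k) * l k := by
    rw [← hsum, ← expWeight_add_sum_sub_mul]
    ring
  have hS : i + expWeight l + η ≡ (i + expWeight l) % q + η + N - q [MOD N] := calc
    _ ≡ (i + expWeight l) % q + η [MOD N] := (((Nat.mod_modEq _ q).of_dvd hNq).add_right η).symm
    _ ≡ (i + expWeight l) % q + η + N [MOD N] := by simp [Nat.ModEq]
    _ ≡ _ [MOD N] := by
      refine ((Nat.modEq_iff_dvd' (Nat.sub_le _ _)).2 ?_).symm
      rwa [Nat.sub_sub_self (by omega)]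
  have hmod : i + (η * j + η) ≡ ((i + expWeight l) % q + η + N - q) +
      ∑ k : Fin (η + 1), (η - k) * (l k % N) [MOD N] :=
    hsplit ▸ hS.add (.sum fun k _ => .mul_left _ (Nat.mod_modEq _ _).symm)
  have := hmod.trans_le (Nat.mod_le _ _)
  rw [exceptionalBound]
  omega

open Classical in
/-- The stably bad pairs of exponents below `q`. -/
noncomputable def stablyBadExps (p η q N : ℕ) : Finset (ℕ × ℕ) :=
  {ij ∈ Finset.range q ×ˢ Finset.range q | IsStablyBad p η q N ij.1 ij.2}

theorem mem_stablyBadExps {ij : ℕ × ℕ} : ij ∈ stablyBadExps p η q N ↔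
    ij ∈ Finset.range q ×ˢ Finset.range q ∧ IsStablyBad p η q N ij.1 ij.2 := by
  simp [stablyBadExps]

theorem card_stablyBadExps_mul_le (hp : 0 < p) :
    (stablyBadExps p η q N).card * p ^ 2 ≤ (stablyBadExps p η (p * q) (p * N)).card := by
  have hcard := card_blockPairs (N := stablyBadExps p η q N)
    (subset_refl (Finset.range p ×ˢ Finset.range p))
  rw [Finset.card_product, Finset.card_range, ← sq] at hcard
  rw [← hcard]
  refine Finset.card_le_card fun ij hij => ?_
  rw [mem_blockPairs subset_rfl, mem_stablyBadExps] at hij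
  simp only [Finset.mem_product, Finset.mem_range, Nat.div_lt_iff_lt_mul hp] at hij
  obtain ⟨⟨hlt, hstable⟩, hmod⟩ := hij
  have := hstable.append hmod.1 hmod.2
  rw [Nat.div_add_mod, Nat.div_add_mod] at this
  simpa [mem_stablyBadExps, mul_comm p q, hlt] using this

theorem card_goodExps_add_card_stablyBadExps_le (hN : N ≤ q) :
    (goodExps p η q (q - N)).card + (stablyBadExps p η q N).card ≤ q ^ 2 := by
  rw [← Finset.card_union_of_disjoint (Finset.disjoint_left.2 fun ij hgood hbad =>
    (mem_stablyBadExps.1 hbad).2.not_isGoodExp hN (mem_goodExps.1 hgood).2), sq,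
    ← Finset.card_range q, ← Finset.card_product, Finset.card_range]
  refine Finset.card_le_card (Finset.union_subset (fun ij h => ?_)
    fun ij h => (mem_stablyBadExps.1 h).1)
  simpa using (mem_goodExps.1 h).1

theorem card_filter_add_mod_lt_le (N Q K : ℕ) (g : ℕ → ℕ) :
    ({ij ∈ Finset.range (N * Q) ×ˢ Finset.range (N * Q) | (ij.1 + g ij.2) % N < K}).card ≤
      N * Q * (Q * K) := by
  have hle := Finset.card_le_card_of_injOn
    (s := {ij ∈ Finset.range (N * Q) ×ˢ Finset.range (N * Q) | (ij.1 + g ij.2) % N < K})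
    (t := Finset.range (N * Q) ×ˢ (Finset.range Q ×ˢ Finset.range K))
    (fun ij => (ij.2, ij.1 / N, (ij.1 + g ij.2) % N)) ?_ ?_
  · simpa using hle
  · intro ij hij
    simp only [Finset.coe_filter, Finset.mem_product, Finset.mem_range, Set.mem_ofPred_eq] at hij
    simp [hij, Nat.div_lt_of_lt_mul]
  · rintro ⟨i, j⟩ _ ⟨i', j'⟩ _ h
    simp only [Prod.mk.injEq] at h
    obtain ⟨rfl, hdiv, hmod⟩ := h
    have hmod' : i % N = i' % N := Nat.ModEq.add_right_cancel' (g j) hmod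
    rw [← Nat.div_add_mod i N, ← Nat.div_add_mod i' N, hdiv, hmod']

theorem sq_le_card_goodExps_add {n c : ℕ} (hp : 1 < p) (hc : 0 < c) (hn : η ≤ n) :
    (p ^ (n + c)) ^ 2 ≤ (goodExps p η (p ^ (n + c)) (p ^ (n + c) - p ^ n)).card +
      (stablyBadExps p η (p ^ (n + c)) (p ^ n)).card +
        p ^ (n + c) * (p ^ c * exceptionalBound p η) := by
  have hηN : η < p ^ n := (Nat.lt_pow_self hp).trans_le (Nat.pow_le_pow_right (by omega) hn)
  have hN2 : 2 * p ^ n ≤ p ^ (n + c) := by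
    rw [pow_add, mul_comm]
    exact Nat.mul_le_mul_left _ (hp.trans_le (Nat.le_self_pow hc.ne' p))
  set q := p ^ (n + c) with hq
  set E := {ij ∈ Finset.range q ×ˢ Finset.range q |
    (ij.1 + (η * ij.2 + η)) % p ^ n < exceptionalBound p η} with hE
  have hcover : Finset.range q ×ˢ Finset.range q ⊆
      goodExps p η q (q - p ^ n) ∪ stablyBadExps p η q (p ^ n) ∪ E := by
    intro ij hij
    have hlt := Finset.mem_product.1 hij
    rw [Finset.mem_range, Finset.mem_range] at hlt
    rw [Finset.mem_union, Finset.mem_union, mem_goodExps, mem_stablyBadExps, hE,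
      Finset.mem_filter]
    by_contra! hcon
    exact (hcon.2 hij).not_gt (mod_lt_exceptionalBound hp rfl (pow_dvd_pow p (Nat.le_add_right n c))
      hN2 hηN hlt.1 hlt.2 (hcon.1.1 hlt) (hcon.1.2 hij))
  have hEcard : E.card ≤ q * (p ^ c * exceptionalBound p η) := by
    simpa [hE, hq, pow_add] using
      card_filter_add_mod_lt_le (p ^ n) (p ^ c) (exceptionalBound p η) fun j => η * j + η
  calc
    q ^ 2 = (Finset.range q ×ˢ Finset.range q).card := by simp [sq]
    _ ≤ _ := (Finset.card_le_card hcover).trans (Finset.card_union_le _ _)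
    _ ≤ _ := Nat.add_le_add (Finset.card_union_le _ _) hEcard

end StablyBad

section Density

variable {p η c : ℕ}

/-- The proportion of the good pairs among all pairs of exponents below `q`. -/
noncomputable def goodDensity (p η q d : ℕ) : ℝ := (goodExps p η q d).card / (q : ℝ) ^ 2

theorem exists_tendsto_stablyBadExps (hp : 0 < p) (η c : ℕ) :
    ∃ S : ℝ, Tendsto (fun n => ((stablyBadExps p η (p ^ (n + c)) (p ^ n)).card : ℝ) /
      ((p ^ (n + c) : ℕ) : ℝ) ^ 2) atTop (𝓝 S) := by
  have hq (n : ℕ) : (0 : ℝ) < ((p ^ (n + c) : ℕ) : ℝ) ^ 2 := by positivity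
  refine ⟨_, tendsto_atTop_ciSup (monotone_nat_of_le_succ fun n => ?_) ⟨1, ?_⟩⟩
  · rw [div_le_div_iff₀ (hq n) (hq (n + 1))]
    have h := Nat.mul_le_mul_right ((p ^ (n + c)) ^ 2)
      (card_stablyBadExps_mul_le (η := η) (q := p ^ (n + c)) (N := p ^ n) hp)
    rw [← pow_succ', ← pow_succ', mul_assoc, ← mul_pow, ← pow_succ', add_right_comm] at h
    exact_mod_cast h
  · rintro _ ⟨n, rfl⟩
    rw [div_le_one (hq n)]
    exact_mod_cast (Nat.le_add_left _ _).trans (card_goodExps_add_card_stablyBadExps_le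
      (Nat.pow_le_pow_right hp (Nat.le_add_right n c)))

theorem exists_tendsto_goodDensity (hp : 1 < p) (hc : 0 < c) (η : ℕ) :
    ∃ R : ℝ, Tendsto (fun e => goodDensity p η (p ^ e) (p ^ e - p ^ (e - c))) atTop (𝓝 R) := by
  obtain ⟨S, hS⟩ := exists_tendsto_stablyBadExps (by omega : 0 < p) η c
  refine ⟨1 - S, (tendsto_add_atTop_iff_nat c).1 ?_⟩
  simp only [Nat.add_sub_cancel]
  have hq (n : ℕ) : (0 : ℝ) < ((p ^ (n + c) : ℕ) : ℝ) := by positivity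
  have herror : Tendsto (fun n => (p ^ c * exceptionalBound p η : ℕ) /
      ((p ^ (n + c) : ℕ) : ℝ)) atTop (𝓝 0) :=
    tendsto_const_nhds.div_atTop (tendsto_natCast_atTop_atTop.comp
      ((tendsto_pow_atTop_atTop_of_one_lt hp).comp (tendsto_add_atTop_nat c)))
  refine tendsto_of_tendsto_of_tendsto_of_le_of_le'
    (by simpa only [sub_zero] using (hS.const_sub 1).sub herror) (hS.const_sub 1) ?_ ?_
  · filter_upwards [eventually_ge_atTop η] with n hn
    have h : ((p ^ (n + c) : ℕ) : ℝ) ^ 2 ≤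
        (goodExps p η (p ^ (n + c)) (p ^ (n + c) - p ^ n)).card +
          (stablyBadExps p η (p ^ (n + c)) (p ^ n)).card +
            (p ^ (n + c) : ℕ) * (p ^ c * exceptionalBound p η : ℕ) := by
      exact_mod_cast sq_le_card_goodExps_add (η := η) hp hc hn
    rw [goodDensity, ← mul_div_mul_left ((p ^ c * exceptionalBound p η : ℕ) : ℝ) _ (hq n).ne',
      ← sq, sub_sub, sub_le_iff_le_add, ← add_div, ← add_div, one_le_div (pow_pos (hq n) 2)]
    linarith
  · filter_upwards with n
    have h : ((goodExps p η (p ^ (n + c)) (p ^ (n + c) - p ^ n)).card : ℝ) +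
        (stablyBadExps p η (p ^ (n + c)) (p ^ n)).card ≤ ((p ^ (n + c) : ℕ) : ℝ) ^ 2 := by
      exact_mod_cast card_goodExps_add_card_stablyBadExps_le
        (Nat.pow_le_pow_right (by omega) (Nat.le_add_right n c))
    rwa [goodDensity, le_sub_iff_add_le, ← add_div, div_le_one (pow_pos (hq n) 2)]

end Density

/-! ### Lines, minimum distance and local correction -/

section DistOn

variable {ι F : Type*} [DecidableEq F]

/-- The number of coordinates in `s` at which two words differ: the Hamming distance of the words
punctured outside `s`. -/
def distOn (s : Finset ι) (u v : ι → F) : ℕ := (s.filter fun i => u i ≠ v i).card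

theorem distOn_comm (s : Finset ι) (u v : ι → F) : distOn s u v = distOn s v u := by
  simp only [distOn, ne_comm]

theorem distOn_triangle (s : Finset ι) (u v w : ι → F) :
    distOn s u w ≤ distOn s u v + distOn s v w := by
  classical
  refine (Finset.card_le_card fun i hi => ?_).trans (Finset.card_union_le _ _)
  rw [Finset.mem_filter] at hi
  by_cases h : u i = v i <;> simp_all

theorem distOn_congr_left {s : Finset ι} {u u' : ι → F} (h : ∀ i ∈ s, u i = u' i) (v : ι → F) :
    distOn s u v = distOn s u' v :=
  congrArg Finset.card (Finset.filter_congr fun i hi => by rw [h i hi])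

end DistOn

section Decoding

variable {F : Type*} [Field F] [DecidableEq F] {d : ℕ} {s : Finset F} {u v : F → F}

theorem card_le_add_distOn (hu : u ∈ RSCode F d) (hv : v ∈ RSCode F d) (huv : u ≠ v)
    (s : Finset F) : s.card ≤ d + distOn s u v := by
  obtain ⟨g, hg, hgu⟩ := mem_RSCode_iff.1 hu
  obtain ⟨h, hh, hhv⟩ := mem_RSCode_iff.1 hv
  rw [← Finset.card_filter_add_card_filter_not (s := s) fun t => u t = v t]
  refine Nat.add_le_add_right (le_of_not_gt fun hcard => huv ?_) _
  have hlt {f : Polynomial F} (hf : f.natDegree ≤ d) :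
      f.degree < (s.filter fun t => u t = v t).card :=
    Polynomial.degree_le_natDegree.trans_lt (by exact_mod_cast hf.trans_lt hcard)
  have hgh : g = h := Polynomial.eq_of_degrees_lt_of_eval_finset_eq _ (hlt hg) (hlt hh)
    fun t ht => by rw [← hgu, ← hhv, (Finset.mem_filter.1 ht).2]
  funext t
  rw [hgu, hhv, hgh]

theorem eq_of_distOn_add_distOn_lt (hu : u ∈ RSCode F d) (hv : v ∈ RSCode F d) {w : F → F}
    (h : d + (distOn s w u + distOn s w v) < s.card) : u = v := by
  by_contra huv
  have hcard := card_le_add_distOn hu hv huv s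
  have htri := distOn_triangle s u w v
  rw [distOn_comm s u w] at htri
  omega

open Classical in
/-- Bounded distance decoding of a Reed-Solomon word punctured outside `s`: a codeword that differs
from `w` on fewer than `τ` coordinates in `s`, and the zero word if there is none. -/
noncomputable def rsDecode (s : Finset F) (d τ : ℕ) (w : F → F) : F → F :=
  if h : ∃ v ∈ RSCode F d, distOn s w v < τ then h.choose else 0

theorem rsDecode_eq {τ : ℕ} {w : F → F} (hv : v ∈ RSCode F d) (hw : distOn s w v < τ)
    (hτ : d + 2 * τ ≤ s.card + 1) : rsDecode s d τ w = v := by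
  have h : ∃ v ∈ RSCode F d, distOn s w v < τ := ⟨v, hv, hw⟩
  obtain ⟨hmem, _⟩ := h.choose_spec
  rw [rsDecode, dif_pos h]
  exact eq_of_distOn_add_distOn_lt hmem hv (s := s) (w := w) (by omega)

end Decoding

section Lines

variable {F : Type*} [Field F]

/-- The point with first coordinate `t` on the line of slope `m` through `x`. -/
def linePoint (x : Fin 2 → F) (m t : F) : Fin 2 → F := ![t, x 1 + m * (t - x 0)]

theorem linePoint_self (x : Fin 2 → F) (m : F) : linePoint x m (x 0) = x := by
  ext i
  fin_cases i <;> simp [linePoint]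

theorem linePoint_injOn (x : Fin 2 → F) :
    Set.InjOn (fun mt : F × F => linePoint x mt.1 mt.2) {mt | mt.2 ≠ x 0} := by
  rintro ⟨m, t⟩ ht ⟨m', t'⟩ _ h
  have h0 : t = t' := congrFun h 0
  have h1 : x 1 + m * (t - x 0) = x 1 + m' * (t' - x 0) := congrFun h 1
  subst h0
  exact Prod.ext (mul_right_cancel₀ (sub_ne_zero.2 ht) (add_left_cancel h1)) rfl

variable {η d : ℕ} {v : (Fin 2 → F) → F}

theorem comp_linePoint_mem_RSCode (hη : 1 ≤ η) (hv : v ∈ liftRS F η d) (x : Fin 2 → F) (m : F) :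
    v ∘ linePoint x m ∈ RSCode F d := by
  obtain ⟨f, hf, rfl⟩ := (mem_liftRS F).1 hv
  have hdeg : (Polynomial.C (x 1) + Polynomial.C m * (Polynomial.X - Polynomial.C (x 0))).natDegree
      ≤ η := by
    refine le_trans ?_ hη
    compute_degree
  convert hf _ hdeg using 2 with t
  simp [eval_aeval_curve, linePoint]

variable [Fintype F] [DecidableEq F]

theorem sum_distOn_linePoint_le (u v : (Fin 2 → F) → F) (x : Fin 2 → F) :
    ∑ m, distOn (Finset.univ.erase (x 0)) (u ∘ linePoint x m) (v ∘ linePoint x m) ≤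
      hammingDist u v := by
  simp only [distOn]
  rw [← Finset.card_sigma]
  refine Finset.card_le_card_of_injOn (fun mt => linePoint x mt.1 mt.2) ?_ ?_
  · rintro ⟨m, t⟩ h
    simp only [Finset.coe_sigma, Set.mem_sigma_iff, Finset.mem_coe, Finset.mem_filter] at h
    simpa using h.2.2
  · rintro ⟨m, t⟩ h ⟨m', t'⟩ h' heq
    simp only [Finset.coe_sigma, Set.mem_sigma_iff, Finset.mem_coe, Finset.mem_filter,
      Finset.mem_erase] at h h'
    have hmt := linePoint_injOn x (x₁ := (m, t)) h.2.1.1 (x₂ := (m', t')) h'.2.1.1 heq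
    simpa using hmt

theorem le_hammingDist_of_mem_liftRS (hη : 1 ≤ η) {u v : (Fin 2 → F) → F} (hu : u ∈ liftRS F η d)
    (hv : v ∈ liftRS F η d) (huv : u ≠ v) :
    Fintype.card F * (Fintype.card F - 1 - d) ≤ hammingDist u v := by
  obtain ⟨x, hx⟩ := Function.ne_iff.1 huv
  refine le_trans ?_ (sum_distOn_linePoint_le u v x)
  rw [← smul_eq_mul, ← Finset.card_univ]
  refine Finset.card_nsmul_le_sum _ _ _ fun m _ => Nat.sub_le_iff_le_add'.2 ?_
  rw [← Finset.card_erase_of_mem (Finset.mem_univ (x 0))]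
  refine card_le_add_distOn (comp_linePoint_mem_RSCode hη hu x m)
    (comp_linePoint_mem_RSCode hη hv x m) (fun h => hx ?_) _
  simpa [linePoint_self] using congrFun h (x 0)

theorem le_codeMinDist_liftRS (hη : 1 ≤ η) (hpos : 0 < Module.finrank F (liftRS F η d)) :
    Fintype.card F * (Fintype.card F - 1 - d) ≤ codeMinDist (liftRS F η d) := by
  have : Nontrivial (liftRS F η d) := Module.nontrivial_of_finrank_pos hpos
  obtain ⟨⟨u, hu⟩, ⟨v, hv⟩, huv⟩ := exists_pair_ne (liftRS F η d)
  refine le_csInf ⟨_, u, hu, v, hv, fun h => huv (Subtype.ext h), rfl⟩ ?_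
  rintro _ ⟨u, hu, v, hv, huv, rfl⟩
  exact le_hammingDist_of_mem_liftRS hη hu hv huv

end Lines

namespace OracleAlg

variable {ι κ F : Type*} [DecidableEq κ]

/-- Read the coordinates `pos t` for `t` in a list, then output a function of the word `w` updated
at those `t` by the symbols read. -/
def readList (pos : κ → ι) (out : (κ → F) → F) : List κ → (κ → F) → OracleAlg ι F
  | [], w => output (out w)
  | t :: ts, w => read (pos t) fun a => readList pos out ts (Function.update w t a)

variable (pos : κ → ι) (out : (κ → F) → F) (y : ι → F)

theorem numReads_readList (ts : List κ) (w : κ → F) :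
    (readList pos out ts w).numReads y = ts.length := by
  induction ts generalizing w with
  | nil => rfl
  | cons t ts ih => simp [readList, numReads, ih]

theorem run_readList (ts : List κ) (w : κ → F) :
    (readList pos out ts w).run y = out fun t => if t ∈ ts then y (pos t) else w t := by
  induction ts generalizing w with
  | nil => simp [readList, run]
  | cons t ts ih =>
    rw [readList, run, ih]
    congr 1
    funext t'
    by_cases hmem : t' ∈ ts
    · simp [hmem]
    · rcases eq_or_ne t' t with rfl | hne <;> simp [*]

end OracleAlg

section LocalCorrection

variable {F : Type*} [Field F] [Fintype F] [DecidableEq F] {η d τ : ℕ}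

/-- The algorithm that reads the line of slope `m` through `x` except for `x` itself, decodes the
punctured Reed-Solomon word found there, and outputs its symbol at `x`. -/
noncomputable def lineAlg (d τ : ℕ) (x : Fin 2 → F) (m : F) : OracleAlg (Fin 2 → F) F :=
  OracleAlg.readList (linePoint x m) (fun w => rsDecode (Finset.univ.erase (x 0)) d τ w (x 0))
    (Finset.univ.erase (x 0)).toList 0

theorem numReads_lineAlg (d τ : ℕ) (x : Fin 2 → F) (m : F) (y : (Fin 2 → F) → F) :
    (lineAlg d τ x m).numReads y = Fintype.card F - 1 := by
  rw [lineAlg, OracleAlg.numReads_readList, Finset.length_toList,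
    Finset.card_erase_of_mem (Finset.mem_univ _), Finset.card_univ]

theorem run_lineAlg (hη : 1 ≤ η) (hτ : d + 2 * τ ≤ Fintype.card F) {x : Fin 2 → F} {m : F}
    {y c : (Fin 2 → F) → F} (hc : c ∈ liftRS F η d)
    (hy : distOn (Finset.univ.erase (x 0)) (y ∘ linePoint x m) (c ∘ linePoint x m) < τ) :
    (lineAlg d τ x m).run y = c x := by
  rw [lineAlg, OracleAlg.run_readList, rsDecode_eq (comp_linePoint_mem_RSCode hη hc x m)]
  · rw [Function.comp_apply, linePoint_self]
  · refine (distOn_congr_left (fun t ht => ?_) _).trans_lt hy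
    rw [if_pos (Finset.mem_toList.2 ht), Function.comp_apply]
  · rwa [Finset.card_erase_add_one (Finset.mem_univ _), Finset.card_univ]

/-- Markov's inequality over the slopes: distinct lines through `x` meet only in `x`. -/
theorem card_run_lineAlg_ne_mul_le (hη : 1 ≤ η) (hτ : d + 2 * τ ≤ Fintype.card F)
    (x : Fin 2 → F) (y : (Fin 2 → F) → F) {c : (Fin 2 → F) → F} (hc : c ∈ liftRS F η d) :
    ({m | (lineAlg d τ x m).run y ≠ c x} : Finset F).card * τ ≤ hammingDist y c := by
  refine le_trans ?_ (sum_distOn_linePoint_le y c x)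
  rw [← smul_eq_mul]
  refine (Finset.card_nsmul_le_sum _ _ τ fun m hm => ?_).trans
    (Finset.sum_le_sum_of_subset (Finset.subset_univ _))
  exact le_of_not_gt fun hlt => (Finset.mem_filter.1 hm).2 (run_lineAlg hη hτ hc hlt)

theorem toReal_map_uniformOfFintype_apply {α β : Type*} [Fintype α] [Nonempty α] [DecidableEq β]
    (f : α → β) (b : β) : ((PMF.uniformOfFintype α).map f b).toReal =
      1 - ({a | f a ≠ b} : Finset α).card / (Fintype.card α : ℝ) := by
  have hcard := Finset.card_filter_add_card_filter_not (s := Finset.univ) fun a => f a = b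
  rw [Finset.card_univ] at hcard
  have hpos : (Fintype.card α : ℝ) ≠ 0 := by exact_mod_cast Fintype.card_ne_zero
  rw [eq_sub_iff_add_eq, ← div_self hpos]
  nth_rw 2 [← hcard]
  rw [Nat.cast_add, add_div, PMF.map_apply, tsum_fintype]
  simp [PMF.uniformOfFintype_apply, ← Finset.sum_filter, eq_comm, div_eq_mul_inv]

theorem isLocallyCorrectable_liftRS (hη : 1 ≤ η) (hτ0 : 0 < τ) (hτ : d + 2 * τ ≤ Fintype.card F)
    {δ ε : ℝ} (hε : δ * Fintype.card F ≤ ε * τ) :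
    IsLocallyCorrectable (liftRS F η d) (Fintype.card F - 1) δ ε := by
  refine ⟨fun x => (PMF.uniformOfFintype F).map (lineAlg d τ x), fun x A hA y => ?_,
    fun x y c hc hdist => ?_⟩
  · obtain ⟨m, -, rfl⟩ := (PMF.mem_support_map_iff _ _ _).1 hA
    exact (numReads_lineAlg d τ x m y).le
  rw [PMF.map_comp, toReal_map_uniformOfFintype_apply]
  simp only [Function.comp_apply]
  have hfail : (({m | (lineAlg d τ x m).run y ≠ c x} : Finset F).card : ℝ) * τ ≤
      hammingDist y c := by
    exact_mod_cast card_run_lineAlg_ne_mul_le hη hτ x y hc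
  have hq : (0 : ℝ) < Fintype.card F := by exact_mod_cast Fintype.card_pos
  have hτ0' : (0 : ℝ) < τ := by exact_mod_cast hτ0
  refine sub_le_sub_left ((div_le_iff₀ hq).2 (le_of_mul_le_mul_right ?_ hτ0')) 1
  calc (_ : ℝ) * τ
    _ ≤ δ * Fintype.card (Fin 2 → F) := hfail.trans hdist
    _ = δ * Fintype.card F * Fintype.card F := by
      rw [Fintype.card_fun, Fintype.card_fin]; push_cast; ring
    _ ≤ ε * τ * Fintype.card F := mul_le_mul_of_nonneg_right hε hq.le
    _ = ε * Fintype.card F * τ := by ring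

end LocalCorrection

/-! ### Rates -/

section RateBound

variable {b η c : ℕ}

/-- The lower bound for the limit rate, with `b` in the place of `p`. -/
noncomputable def rateLowerBound (b η c : ℕ) : ℝ :=
  1 / (2 * (η : ℝ)) * ∑ ε ∈ Finset.range c,
    (((b : ℝ) ^ ε)⁻¹ - ((b : ℝ) ^ c)⁻¹) ^ 2 * seqN b η ε

theorem rateLowerBound_pos (hb : 1 < b) (hη : 0 < η) (hc : 0 < c) : 0 < rateLowerBound b η c := by
  refine mul_pos (by positivity) (Finset.sum_pos' (fun ε _ => ?_) ⟨0, Finset.mem_range.2 hc, ?_⟩)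
  · rw [seqN_eq_card_primPairs (by omega) hη]
    positivity
  · have hinv : ((b : ℝ) ^ c)⁻¹ < 1 :=
      inv_lt_one_of_one_lt₀ (one_lt_pow₀ (by exact_mod_cast hb) hc.ne')
    rw [seqN, pow_zero, inv_one, mul_one]
    exact pow_pos (sub_pos.2 hinv) 2

theorem mul_sq_le_card_triangle {ν e : ℕ} (hb : 1 < b) (hη : 0 < η) (hν : ν < c)
    (he : c + η ≤ e) :
    1 / (2 * (η : ℝ)) * ((((b : ℝ) ^ ν)⁻¹ - ((b : ℝ) ^ c)⁻¹ - (η + 1) * ((b : ℝ) ^ e)⁻¹) ^ 2) *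
      ((b : ℝ) ^ e) ^ 2 ≤ (triangle η (b ^ (e - ν) - b ^ (e - c) - η)).card := by
  have hb0 : (b : ℝ) ≠ 0 := by exact_mod_cast (by omega : b ≠ 0)
  have hηN : η < b ^ (e - c) :=
    (Nat.lt_pow_self hb).trans_le (Nat.pow_le_pow_right (by omega) (by omega))
  have h2N : 2 * b ^ (e - c) ≤ b ^ (e - ν) := calc
    2 * b ^ (e - c) ≤ b * b ^ (e - c) := Nat.mul_le_mul_right _ hb
    _ = b ^ (e - c + 1) := (pow_succ' _ _).symm
    _ ≤ b ^ (e - ν) := Nat.pow_le_pow_right (by omega) (by omega)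
  refine le_of_eq_of_le ?_ (le_card_triangle (A := b ^ (e - ν) - b ^ (e - c) - η) hη (by omega))
  rw [Nat.cast_sub (by omega), Nat.cast_sub (by omega), Nat.cast_pow, Nat.cast_pow,
    pow_sub₀ _ hb0 (by omega : ν ≤ e), pow_sub₀ _ hb0 (by omega : c ≤ e)]
  field_simp
  ring

theorem sum_le_goodDensity {p s e : ℕ} (hb : b = p ^ s) (hb1 : 1 < b) (hη : 0 < η)
    (he : c + η ≤ e) :
    1 / (2 * (η : ℝ)) * ∑ ν ∈ Finset.range c,
        (((b : ℝ) ^ ν)⁻¹ - ((b : ℝ) ^ c)⁻¹ - (η + 1) * ((b : ℝ) ^ e)⁻¹) ^ 2 * seqN b η ν ≤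
      goodDensity p η (b ^ e) (b ^ e - b ^ (e - c)) := by
  have hcount : (∑ ν ∈ Finset.range c, ((primPairs b η ν).card : ℝ) *
      (triangle η (b ^ (e - ν) - b ^ (e - c) - η)).card) ≤
      (goodExps p η (b ^ e) (b ^ e - b ^ (e - c))).card := by
    exact_mod_cast sum_card_le_card_goodExps (c := c) hb (by omega) hη (by omega)
  have hq : 0 < ((b ^ e : ℕ) : ℝ) := by positivity
  rw [goodDensity, le_div_iff₀ (pow_pos hq 2), Nat.cast_pow, Finset.mul_sum, Finset.sum_mul]
  refine (Finset.sum_le_sum fun ν hν => ?_).trans hcount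
  have hmul := mul_le_mul_of_nonneg_left
    (mul_sq_le_card_triangle hb1 hη (Finset.mem_range.1 hν) he)
    (Nat.cast_nonneg (α := ℝ) (primPairs b η ν).card)
  rw [seqN_eq_card_primPairs (by omega) hη]
  refine le_of_eq_of_le ?_ hmul
  ring

theorem rateLowerBound_le_of_tendsto {p s : ℕ} {R : ℝ} (hb : b = p ^ s) (hb1 : 1 < b) (hη : 0 < η)
    (hR : Tendsto (fun e => goodDensity p η (b ^ e) (b ^ e - b ^ (e - c))) atTop (𝓝 R)) :
    rateLowerBound b η c ≤ R := by
  have hinv : Tendsto (fun e : ℕ => (η + 1 : ℝ) * ((b : ℝ) ^ e)⁻¹) atTop (𝓝 0) := by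
    have hpow := tendsto_pow_atTop_atTop_of_one_lt (Nat.one_lt_cast.2 hb1 : (1 : ℝ) < b)
    simpa only [mul_zero, Function.comp_apply] using
      (tendsto_inv_atTop_zero.comp hpow).const_mul (η + 1 : ℝ)
  refine le_of_tendsto_of_tendsto (Tendsto.const_mul _ (tendsto_finsetSum _ fun ν _ => ?_)) hR
    (eventually_atTop.2 ⟨c + η, fun e he => sum_le_goodDensity hb hb1 hη he⟩)
  simpa only [sub_zero] using ((hinv.const_sub _).pow 2).mul_const (seqN b η ν)

theorem exists_tendsto_goodDensity_pow {p s : ℕ} (hp : 1 < p) (hs : 0 < s) (hc : 0 < c) (η : ℕ) :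
    ∃ R : ℝ, Tendsto
      (fun e => goodDensity p η ((p ^ s) ^ e) ((p ^ s) ^ e - (p ^ s) ^ (e - c))) atTop (𝓝 R) := by
  obtain ⟨R, hR⟩ := exists_tendsto_goodDensity hp (Nat.mul_pos hs hc) η
  refine ⟨R, ?_⟩
  simpa only [Function.comp_def, id, ← Nat.mul_sub, pow_mul] using
    hR.comp (tendsto_id.const_mul_atTop' hs)

end RateBound

section Rate

variable {F : Type*} [Field F] [Fintype F] {η d N : ℕ}

theorem codeRate_liftRS {p : ℕ} [CharP F p] (hd : d + 1 < Fintype.card F) :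
    codeRate (liftRS F η d) = goodDensity p η (Fintype.card F) d := by
  rw [codeRate, finrank_liftRS (p := p) hd, goodDensity, Fintype.card_fun, Fintype.card_fin,
    Nat.cast_pow]

theorem card_le_finrank {C : Submodule F ((Fin 2 → F) → F)} {ρ : ℝ} (hρ : ρ ≤ codeRate C)
    (hq : 1 ≤ ρ * Fintype.card F) : Fintype.card F ≤ Module.finrank F C := by
  have hq0 : (0 : ℝ) < Fintype.card F := by exact_mod_cast Fintype.card_pos
  rw [codeRate, Fintype.card_fun, Fintype.card_fin, Nat.cast_pow,
    le_div_iff₀ (pow_pos hq0 2)] at hρ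
  have : (Fintype.card F : ℝ) ≤ Module.finrank F C := by nlinarith
  exact_mod_cast this

variable [DecidableEq F]

variable {b c e : ℕ}

theorem two_le_pow_sub (hb : 1 < b) (hce : c + 1 ≤ e) : 2 ≤ b ^ (e - c) :=
  hb.trans_le (Nat.le_self_pow (by omega) b)

theorem mul_card_le_codeMinDist_liftRS (hη : 1 ≤ η) (hb : 1 < b) (hF : Fintype.card F = b ^ e)
    (hce : c + 1 ≤ e) (hpos : 0 < Module.finrank F (liftRS F η (b ^ e - b ^ (e - c)))) :
    ((b : ℝ) ^ c)⁻¹ / 2 * Fintype.card (Fin 2 → F) ≤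
      codeMinDist (liftRS F η (b ^ e - b ^ (e - c))) := by
  have hN := two_le_pow_sub hb hce
  have hle : b ^ (e - c) ≤ b ^ e := Nat.pow_le_pow_right (by omega) (Nat.sub_le e c)
  have hdist := le_codeMinDist_liftRS hη hpos
  rw [hF, show b ^ e - 1 - (b ^ e - b ^ (e - c)) = b ^ (e - c) - 1 by omega] at hdist
  have hhalf : (b : ℝ) ^ (e - c) / 2 ≤ (b ^ (e - c) - 1 : ℕ) := by
    rw [div_le_iff₀ two_pos]
    exact_mod_cast (by omega : b ^ (e - c) ≤ (b ^ (e - c) - 1) * 2)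
  have hq : (b : ℝ) ^ (e - c) * (b : ℝ) ^ c = (b : ℝ) ^ e :=
    pow_sub_mul_pow _ (by omega)
  have hb0 : (b : ℝ) ^ c ≠ 0 := by positivity
  calc ((b : ℝ) ^ c)⁻¹ / 2 * Fintype.card (Fin 2 → F)
    _ = (b : ℝ) ^ e * ((b : ℝ) ^ (e - c) / 2) := by
      rw [Fintype.card_fun, Fintype.card_fin, hF, Nat.cast_pow, Nat.cast_pow, ← hq]
      field_simp
    _ ≤ (b : ℝ) ^ e * (b ^ (e - c) - 1 : ℕ) := by gcongr
    _ ≤ _ := by exact_mod_cast hdist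

theorem isLocallyCorrectable_liftRS_pow (hη : 1 ≤ η) (hb : 1 < b) (hF : Fintype.card F = b ^ e)
    (hce : c + 1 ≤ e) {n : ℕ} (hn : b ^ (e - c) ≤ n * (b ^ (e - c) / 2)) {δ : ℝ} (hδ : 0 ≤ δ) :
    IsLocallyCorrectable (liftRS F η (b ^ e - b ^ (e - c))) (b ^ e - 1) δ (n * b ^ c * δ) := by
  have h2 := two_le_pow_sub hb hce
  have hle : b ^ (e - c) ≤ b ^ e := Nat.pow_le_pow_right (by omega) (Nat.sub_le e c)
  rw [← hF]
  refine isLocallyCorrectable_liftRS (τ := b ^ (e - c) / 2) hη (by omega) (by omega) ?_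
  rw [hF, ← pow_sub_mul_pow b (by omega : c ≤ e)]
  calc δ * (b ^ (e - c) * b ^ c : ℕ)
    _ ≤ δ * (n * (b ^ (e - c) / 2) * b ^ c : ℕ) := by gcongr
    _ = n * b ^ c * δ * (b ^ (e - c) / 2 : ℕ) := by push_cast; ring

end Rate

section Family

theorem tendsto_card_atTop {F : ℕ → Type*} [∀ e, Fintype (F e)] {b : ℕ} (hb : 1 < b)
    (hF : ∀ e, 1 ≤ e → Fintype.card (F e) = b ^ e) :
    Tendsto (fun e => Fintype.card (F e)) atTop atTop :=
  (tendsto_pow_atTop_atTop_of_one_lt hb).congr'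
    (eventually_atTop.2 ⟨1, fun e he => (hF e he).symm⟩)

variable {F : ℕ → Type*} [∀ e, Field (F e)] [∀ e, Fintype (F e)] {b η c : ℕ}

theorem floor_rate_mul_pow {e : ℕ} (hb : 0 < b) (hce : c ≤ e) :
    ⌊(1 - ((b : ℝ) ^ c)⁻¹) * (b : ℝ) ^ e⌋₊ = b ^ e - b ^ (e - c) := by
  have hb0 : (b : ℝ) ≠ 0 := by positivity
  rw [← Nat.floor_natCast (R := ℝ) (b ^ e - b ^ (e - c)),
    Nat.cast_sub (Nat.pow_le_pow_right hb (Nat.sub_le e c)), Nat.cast_pow, Nat.cast_pow,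
    pow_sub₀ _ hb0 hce, sub_mul, one_mul, mul_comm ((b : ℝ) ^ e)]

variable {C : ∀ e, Submodule (F e) ((Fin 2 → F e) → F e)} {ρ : ℝ}

theorem exists_tendsto_codeRate (hη : 1 ≤ η) (hc : 1 ≤ c)
    (hF : ∀ e, 1 ≤ e → Fintype.card (F e) = b ^ e)
    (hC : ∀ e, c + 1 ≤ e → C e = liftRS (F e) η (b ^ e - b ^ (e - c))) :
    ∃ R : ℝ, Tendsto (fun e => codeRate (C e)) atTop (𝓝 R) ∧ rateLowerBound b η c ≤ R := by
  obtain ⟨p, s, hp, hs, hb⟩ := Fintype.isPrimePow_card_of_field (α := F 1)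
  rw [hF 1 le_rfl, pow_one] at hb
  rw [← Nat.prime_iff] at hp
  have := Fact.mk hp
  have hb1 : 1 < b := hb ▸ Nat.one_lt_pow hs.ne' hp.one_lt
  obtain ⟨R, hR⟩ := exists_tendsto_goodDensity_pow hp.one_lt hs hc η
  rw [hb] at hR
  refine ⟨R, hR.congr' ?_, rateLowerBound_le_of_tendsto hb.symm hb1 hη hR⟩
  filter_upwards [eventually_ge_atTop (c + 1)] with e he
  have hcard := hF e (by omega)
  have : CharP (F e) p := charP_of_card_eq_prime_pow (f := s * e) (by rw [hcard, ← hb, pow_mul])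
  have hN := two_le_pow_sub hb1 he
  have hle : b ^ (e - c) ≤ b ^ e := Nat.pow_le_pow_right (by omega) (Nat.sub_le e c)
  rw [hC e he, codeRate_liftRS (p := p) (by omega), hcard]

theorem eventually_card_le_finrank (hcard : Tendsto (fun e => Fintype.card (F e)) atTop atTop)
    (hρ0 : 0 < ρ) (hρ : ∀ᶠ e in atTop, ρ ≤ codeRate (C e)) :
    ∀ᶠ e in atTop, Fintype.card (F e) ≤ Module.finrank (F e) (C e) := by
  have hlarge := ((tendsto_natCast_atTop_atTop (R := ℝ)).comp hcard).const_mul_atTop hρ0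
  filter_upwards [hρ, hlarge.eventually_ge_atTop 1] with e hρe hle
  exact card_le_finrank hρe hle

theorem asymptoticallyGood_liftRS [∀ e, DecidableEq (F e)] (hη : 1 ≤ η) (hb : 1 < b)
    (hF : ∀ e, 1 ≤ e → Fintype.card (F e) = b ^ e)
    (hC : ∀ e, c + 1 ≤ e → C e = liftRS (F e) η (b ^ e - b ^ (e - c)))
    (hρ0 : 0 < ρ) (hρ : ∀ᶠ e in atTop, ρ ≤ codeRate (C e)) : AsymptoticallyGood C := by
  have hcard := tendsto_card_atTop hb hF
  refine ⟨?_, ρ, hρ0, ((b : ℝ) ^ c)⁻¹ / 2, by positivity, ?_⟩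
  · simpa only [Fintype.card_fun, Fintype.card_fin, Function.comp_def] using
      (tendsto_pow_atTop two_ne_zero).comp hcard
  · filter_upwards [hρ, eventually_card_le_finrank hcard hρ0 hρ, eventually_ge_atTop (c + 1)]
      with e hρe hrank he
    refine ⟨hρe, ?_⟩
    rw [hC e he] at hrank ⊢
    exact mul_card_le_codeMinDist_liftRS hη hb (hF e (by omega)) he
      (Fintype.card_pos.trans_le hrank)

end Family

theorem mainTheorem2_general (b η c : ℕ) (hη : 1 ≤ η) (hc : 1 ≤ c)
    (γ : ℝ) (hγ : γ = 1 - ((b : ℝ) ^ c)⁻¹)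
    (F : ℕ → Type*) [∀ e, Field (F e)] [∀ e, Fintype (F e)] [∀ e, DecidableEq (F e)]
    (hF : ∀ e, 1 ≤ e → Fintype.card (F e) = b ^ e)
    (C : ∀ e, Submodule (F e) ((Fin 2 → F e) → F e))
    (hC : ∀ e, c + 1 ≤ e → C e = liftRS (F e) η ⌊γ * (b : ℝ) ^ e⌋₊) :
    (∃ R : ℝ, Tendsto (fun e => codeRate (C e)) atTop (𝓝 R) ∧ rateLowerBound b η c ≤ R) ∧
    0 < rateLowerBound b η c ∧
    AsymptoticallyGood C ∧
    (∀ᶠ e in atTop, b ^ e - 1 ≤ Module.finrank (F e) (C e)) ∧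
    ∀ e, c + 1 ≤ e → ∀ δ : ℝ, 0 ≤ δ →
      IsLocallyCorrectable (C e) (b ^ e - 1) δ (3 / (1 - γ) * δ) ∧
      (Even (b ^ e - ⌊γ * (b : ℝ) ^ e⌋₊) →
        IsLocallyCorrectable (C e) (b ^ e - 1) δ (2 / (1 - γ) * δ)) := by
  have hb : 1 < b := by simpa [hF 1 le_rfl] using Fintype.one_lt_card (α := F 1)
  have hfloor : ∀ e, c + 1 ≤ e → ⌊γ * (b : ℝ) ^ e⌋₊ = b ^ e - b ^ (e - c) := fun e he =>
    hγ ▸ floor_rate_mul_pow (by omega) (by omega)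
  have hC' : ∀ e, c + 1 ≤ e → C e = liftRS (F e) η (b ^ e - b ^ (e - c)) := fun e he => by
    rw [hC e he, hfloor e he]
  obtain ⟨R, hrate, hle⟩ := exists_tendsto_codeRate hη hc hF hC'
  have hpos := rateLowerBound_pos hb hη hc
  have hR : 0 < R := hpos.trans_le hle
  have hρ : ∀ᶠ e in atTop, R / 2 ≤ codeRate (C e) := hrate.eventually_const_le (half_lt_self hR)
  have hrank := eventually_card_le_finrank (tendsto_card_atTop hb hF) (half_pos hR) hρ
  refine ⟨⟨R, hrate, hle⟩, hpos, asymptoticallyGood_liftRS hη hb hF hC' (half_pos hR) hρ, ?_,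
    fun e he δ hδ => ?_⟩
  · filter_upwards [hrank, eventually_ge_atTop 1] with e hrank he
    exact (Nat.sub_le _ _).trans (hF e he ▸ hrank)
  · have hlocal {n : ℕ} (hn : b ^ (e - c) ≤ n * (b ^ (e - c) / 2)) :
        IsLocallyCorrectable (C e) (b ^ e - 1) δ (n / (1 - γ) * δ) := by
      rw [hC' e he, hγ, sub_sub_cancel, div_inv_eq_mul]
      exact isLocallyCorrectable_liftRS_pow hη hb (hF e (by omega)) he hn hδ
    refine ⟨hlocal (n := 3) ?_, fun heven => hlocal (n := 2) ?_⟩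
    · have := two_le_pow_sub hb he
      omega
    · rw [hfloor e he, Nat.sub_sub_self (Nat.pow_le_pow_right (by omega) (Nat.sub_le e c))] at heven
      exact (Nat.mul_div_cancel' heven.two_dvd).ge

theorem mainTheorem2 (p η c : ℕ) (hp : p.Prime) (hη : 1 ≤ η) (hc : 1 ≤ c)
    (γ : ℝ) (hγ : γ = 1 - ((p : ℝ) ^ c)⁻¹)
    (F : ℕ → Type*) [∀ e, Field (F e)] [∀ e, Fintype (F e)] [∀ e, DecidableEq (F e)]
    (hF : ∀ e, 1 ≤ e → Fintype.card (F e) = p ^ e)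
    (C : ∀ e, Submodule (F e) ((Fin 2 → F e) → F e))
    (hC : ∀ e, c + 1 ≤ e → C e = liftRS (F e) η ⌊γ * (p : ℝ) ^ e⌋₊) :
    -- the information rates converge, and their limit satisfies the lower bound
    (∃ R : ℝ, Tendsto (fun e => codeRate (C e)) atTop (𝓝 R) ∧
      1 / (2 * (η : ℝ)) * ∑ ε ∈ Finset.range c,
        (((p : ℝ) ^ ε)⁻¹ - ((p : ℝ) ^ c)⁻¹) ^ 2 * seqN p η ε ≤ R) ∧
    -- the lower bound is positive
    0 < 1 / (2 * (η : ℝ)) * ∑ ε ∈ Finset.range c,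
        (((p : ℝ) ^ ε)⁻¹ - ((p : ℝ) ^ c)⁻¹) ^ 2 * seqN p η ε ∧
    AsymptoticallyGood C ∧
    -- local correction from a constant fraction of errors, reading `p ^ e - 1` of `p ^ (2 e)`
    -- symbols, a number which does not exceed the dimension for large `e`
    (∀ᶠ e in atTop, p ^ e - 1 ≤ Module.finrank (F e) (C e)) ∧
    ∀ e, c + 1 ≤ e → ∀ δ : ℝ, 0 < δ → δ ≤ (1 - γ) / 4 →
      IsLocallyCorrectable (C e) (p ^ e - 1) δ (3 / (1 - γ) * δ) ∧
      (Even (p ^ e - ⌊γ * (p : ℝ) ^ e⌋₊) →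
        IsLocallyCorrectable (C e) (p ^ e - 1) δ (2 / (1 - γ) * δ)) := by
  obtain ⟨hlim, hpos, hgood, hrank, hlocal⟩ := mainTheorem2_general p η c hη hc γ hγ F hF C hC
  exact ⟨hlim, hpos, hgood, hrank, fun e he δ hδ _ => hlocal e he δ hδ.le⟩
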